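/- Let $n \ge 0$ be an integer. Let $H_n(0)$ be the $0$-Hecke algebra: the $\mathbb{C}$-algebra generated by $\pi_1, \dots, \pi_{n-1}$ subject to the relations $\pi_i^2 = \pi_i$ for $1 \le i \le n-1$, $\pi_i \pi_{i+1} \pi_i = \pi_{i+1} \pi_i \pi_{i+1}$ for $1 \le i \le n-2$, and $\pi_i \pi_j = \pi_j \pi_i$ for $|i-j| \ge 2$. (For $n \le 1$ there are no generators and $H_n(0) = \mathbb{C}$.) Let $\alpha = (\alpha_1, \dots, \alpha_k)$ be a composition of $n$, that is, a finite (for $n = 0$, empty) sequence of positive integers with sum $n$. The composition diagram of $\alpha$ is the left-justified array of $n$ boxes whose $i$th row from the top has $\alpha_i$ boxes. A standard immaculate tableau of shape $\alpha$ is a filling of this diagram with $1, 2, \dots, n$, each used exactly once, such that the entries of every row increase from left to right and the entries of the first column increase from top to bottom. Let $\mathcal{V}_\alpha$ be the left $H_n(0)$-module whose underlying $\mathbb{C}$-vector space has as basis the set of standard immaculate tableaux of shape $\alpha$, with action given, for $1 \le i \le n-1$, by \[ \pi_i \cdot \mathcal{T} = \begin{cases} \mathcal{T} & \text{if } i \text{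 is not strictly above } i+1 \text{ in } \mathcal{T}, \\ 0 & \text{if } i \text{ and } i+1 \text{ are both in the first column of } \mathcal{T}, \\ s_i \cdot \mathcal{T} & \text{otherwise,} \end{cases} \] where $s_i \cdot \mathcal{T}$ is obtained from $\mathcal{T}$ by swapping $i$ and $i+1$. A projective cover of an $H_n(0)$-module $M$ is a surjective homomorphism $f : P \to M$ with $P$ projective such that every homomorphism $g : X \to P$ with $f \circ g$ surjective is itself surjective. When $M$ is finite dimensional, it has a projective cover, which is unique up to isomorphism; the syzygy module of $M$ is $\Omega(M) := \ker f$. A finite dimensional module $M$ is called essentially rigid if $\operatorname{Hom}_{H_n(0)}(\Omega(M), M) = 0$. Let $\le_l$ denote the lexicographic order on compositions of $n$. **Theorem.** Let $\alpha$ be a composition of $n$. (a) For every composition $\beta$ of $n$ with $\beta \le_l \alpha$, $\operatorname{Ext}^1_{H_n(0)}(\mathcal{V}_\alpha, \mathcal{V}_\beta) = 0$. Moreover, $\mathcal{V}_\alpha$ is essentially rigid. (b) For every composition $\beta$ of $n$ with $\beta \le_l \alpha$, as complex vector spaces, \[ \operatorname{Hom}_{H_n(0)}(\mathcal{V}_\alpha,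 \mathcal{V}_\beta) \cong \begin{cases} \mathbb{C} & \text{if } \beta = \alpha, \\ 0 & \text{otherwise.} \end{cases} \] (c) For every nonzero quotient module $M$ of $\mathcal{V}_\alpha$, $\operatorname{End}_{H_n(0)}(M) \cong \mathbb{C}$ as $\mathbb{C}$-algebras. -/

import Mathlib

noncomputable section

namespace ZeroHecke

/-! ### The 0-Hecke algebra -/

/-- The defining relations of the 0-Hecke algebra of rank `n`. The generator with index
`i : Fin (n - 1)` is the one usually written `π_{i+1}`. -/
inductive Rel (n : ℕ) : FreeAlgebra ℂ (Fin (n - 1)) → FreeAlgebra ℂ (Fin (n - 1)) → Prop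
  | idem (i : Fin (n - 1)) :
      Rel n (FreeAlgebra.ι ℂ i * FreeAlgebra.ι ℂ i) (FreeAlgebra.ι ℂ i)
  | braid (i j : Fin (n - 1)) (h : (i : ℕ) + 1 = j) :
      Rel n (FreeAlgebra.ι ℂ i * FreeAlgebra.ι ℂ j * FreeAlgebra.ι ℂ i)
        (FreeAlgebra.ι ℂ j * FreeAlgebra.ι ℂ i * FreeAlgebra.ι ℂ j)
  | comm (i j : Fin (n - 1)) (h : (i : ℕ) + 2 ≤ j) :
      Rel n (FreeAlgebra.ι ℂ i * FreeAlgebra.ι ℂ j) (FreeAlgebra.ι ℂ j * FreeAlgebra.ι ℂ i)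

/-- The 0-Hecke algebra `H_n(0)` over `ℂ`, by generators and relations. -/
abbrev H (n : ℕ) : Type := RingQuot (Rel n)

/-- The generators `π_i` of `H_n(0)`. -/
def gen {n : ℕ} (i : Fin (n - 1)) : H n := RingQuot.mkAlgHom ℂ (Rel n) (FreeAlgebra.ι ℂ i)

/-! ### Compositions, diagrams and standard immaculate tableaux -/

/-- The lexicographic order on compositions of `n` (as lists of parts): `β ≤_l α`. -/
def LexLE {n : ℕ} (β α : Composition n) : Prop :=
  β = α ∨ List.Lex (· < ·) β.blocks α.blocks

/-- The boxes of the composition diagram of `α`: the box `⟨i, j⟩` lies in row `i` (from the top)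
and column `j` (from the left), both counted from `0`; row `i` has as many boxes as the
`i`-th part of `α`. -/
abbrev Cell {n : ℕ} (α : Composition n) : Type := Σ i : Fin α.length, Fin (α.blocksFun i)

/-- The row of a box, counted from the top. -/
def row {n : ℕ} {α : Composition n} (c : Cell α) : ℕ := c.1

/-- The column of a box, counted from the left; the first column is column `0`. -/
def col {n : ℕ} {α : Composition n} (c : Cell α) : ℕ := c.2

/-- Fillings of the composition diagram with the entries `1, …, n`, each used once. The entry
`k + 1` is encoded as `k : Fin n`. -/
abbrev Filling {n : ℕ} (α : Composition n) : Type := Cell α ≃ Fin n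

/-- The index `i` as an entry. -/
def lo {n : ℕ} (i : Fin (n - 1)) : Fin n := ⟨i, by omega⟩

/-- The successor of the index `i` as an entry. -/
def hi {n : ℕ} (i : Fin (n - 1)) : Fin n := ⟨i + 1, by omega⟩

/-- The filling `s_i · T`, in which the entries `i` and `i + 1` of `T` are swapped. -/
def swapEntries {n : ℕ} {α : Composition n} (i : Fin (n - 1)) (T : Filling α) : Filling α :=
  T.trans (Equiv.swap (lo i) (hi i))

/-- `i` is a descent of `T`: the entry `i` is strictly above the entry `i + 1`. -/
def IsDescent {n : ℕ} {α : Composition n} (i : Fin (n - 1)) (T : Filling α) : Prop :=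
  row (T.symm (lo i)) < row (T.symm (hi i))

/-- The entries `i` and `i + 1` of `T` are both in the first column. -/
def BothFirstColumn {n : ℕ} {α : Composition n} (i : Fin (n - 1)) (T : Filling α) : Prop :=
  col (T.symm (lo i)) = 0 ∧ col (T.symm (hi i)) = 0

instance {n : ℕ} {α : Composition n} (i : Fin (n - 1)) (T : Filling α) :
    Decidable (IsDescent i T) :=
  inferInstanceAs (Decidable (_ < _))

instance {n : ℕ} {α : Composition n} (i : Fin (n - 1)) (T : Filling α) :
    Decidable (BothFirstColumn i T) :=
  inferInstanceAs (Decidable (_ ∧ _))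

/-- Standard immaculate tableaux of shape `α`: entries increase from left to right in every row,
and from top to bottom in the first column. -/
structure SIT {n : ℕ} (α : Composition n) : Type where
  /-- the underlying filling -/
  entry : Filling α
  row_lt : ∀ c d : Cell α, row c = row d → col c < col d → entry c < entry d
  col_lt : ∀ c d : Cell α, col c = 0 → col d = 0 → row c < row d → entry c < entry d

theorem SIT.entry_injective {n : ℕ} {α : Composition n} :
    Function.Injective (SIT.entry : SIT α → Filling α) := by
  rintro ⟨T, _, _⟩ ⟨U, _, _⟩ h
  cases h
  rfl

/-- Swapping two consecutive entries keeps their order against each other entry. -/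
theorem swap_lt_swap {n : ℕ} (i : Fin (n - 1)) {a b : Fin n} (hab : a < b)
    (hne : ¬(a = lo i ∧ b = hi i)) :
    Equiv.swap (lo i) (hi i) a < Equiv.swap (lo i) (hi i) b := by
  have key : ∀ x : Fin n, ((Equiv.swap (lo i) (hi i) x : Fin n) : ℕ) =
      if (x : ℕ) = i then (i : ℕ) + 1 else if (x : ℕ) = i + 1 then (i : ℕ) else x := fun x => by
    rw [Equiv.swap_apply_def]
    simp only [Fin.ext_iff, lo, hi]
    split_ifs <;> rfl
  simp only [Fin.ext_iff, Fin.lt_def, lo, hi] at hab hne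
  rw [Fin.lt_def, key, key]
  split_ifs <;> omega

/-- The standard immaculate tableau `s_i · T`, for a descent `i` of `T` such that `i` and `i + 1`
are not both in the first column. -/
def SIT.swap {n : ℕ} {α : Composition n} (i : Fin (n - 1)) (T : SIT α)
    (hd : IsDescent i T.entry) (hc : ¬BothFirstColumn i T.entry) : SIT α where
  entry := swapEntries i T.entry
  row_lt c d hr hlt := by
    refine swap_lt_swap i (T.row_lt c d hr hlt) ?_
    rintro ⟨h1, h2⟩
    have e1 : T.entry.symm (lo i) = c := by rw [← h1, Equiv.symm_apply_apply]
    have e2 : T.entry.symm (hi i) = d := by rw [← h2, Equiv.symm_apply_apply]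
    rw [IsDescent, e1, e2, hr] at hd
    exact lt_irrefl _ hd
  col_lt c d h0 h0' hlt := by
    refine swap_lt_swap i (T.col_lt c d h0 h0' hlt) ?_
    rintro ⟨h1, h2⟩
    have e1 : T.entry.symm (lo i) = c := by rw [← h1, Equiv.symm_apply_apply]
    have e2 : T.entry.symm (hi i) = d := by rw [← h2, Equiv.symm_apply_apply]
    rw [BothFirstColumn, e1, e2] at hc
    exact hc ⟨h0, h0'⟩

/-! ### The module `V_α` -/

/-- The complex vector space with basis the standard immaculate tableaux of shape `α`. -/
def V {n : ℕ} (α : Composition n) : Type := SIT α →₀ ℂ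

instance {n : ℕ} (α : Composition n) : AddCommGroup (V α) :=
  inferInstanceAs (AddCommGroup (SIT α →₀ ℂ))

instance {n : ℕ} (α : Composition n) : Module ℂ (V α) :=
  inferInstanceAs (Module ℂ (SIT α →₀ ℂ))

/-- The basis vector of `V α` given by a tableau. -/
def V.basisVec {n : ℕ} {α : Composition n} (T : SIT α) : V α :=
  (Finsupp.single T 1 : SIT α →₀ ℂ)

/-- The value of `π_i` on a basis vector. -/
def actBasis {n : ℕ} {α : Composition n} (i : Fin (n - 1)) (T : SIT α) : V α :=
  if hd : IsDescent i T.entry then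
    if hc : BothFirstColumn i T.entry then 0
    else V.basisVec (T.swap i hd hc)
  else V.basisVec T

/-- The `ℂ`-linear action of `π_i` on `V α`. -/
def act {n : ℕ} (α : Composition n) (i : Fin (n - 1)) : Module.End ℂ (V α) :=
  (Finsupp.linearCombination ℂ (actBasis i) : (SIT α →₀ ℂ) →ₗ[ℂ] V α)

theorem act_basisVec {n : ℕ} {α : Composition n} (i : Fin (n - 1)) (T : SIT α) :
    act α i (V.basisVec T) = actBasis i T :=
  (Finsupp.linearCombination_single ℂ 1 T).trans (one_smul ℂ _)

/-! The relations are checked on the larger space spanned by all fillings. -/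

/-- The formula for `π_i`, on an arbitrary filling. -/
def fillBasis {n : ℕ} {α : Composition n} (i : Fin (n - 1)) (T : Filling α) : Filling α →₀ ℂ :=
  if IsDescent i T then
    if BothFirstColumn i T then 0 else Finsupp.single (swapEntries i T) 1
  else Finsupp.single T 1

/-- The formula for `π_i`, extended linearly to the span of all fillings. -/
def fillAct {n : ℕ} (α : Composition n) (i : Fin (n - 1)) : Module.End ℂ (Filling α →₀ ℂ) :=
  Finsupp.linearCombination ℂ (fillBasis i)

/-- The inclusion of `V α` in the span of all fillings. -/
def incl {n : ℕ} (α : Composition n) : V α →ₗ[ℂ] (Filling α →₀ ℂ) :=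
  Finsupp.lmapDomain ℂ ℂ SIT.entry

theorem incl_injective {n : ℕ} (α : Composition n) : Function.Injective (incl α) :=
  Finsupp.mapDomain_injective SIT.entry_injective

theorem incl_act {n : ℕ} (α : Composition n) (i : Fin (n - 1)) (v : V α) :
    incl α (act α i v) = fillAct α i (incl α v) := by
  suffices h : incl α ∘ₗ act α i = fillAct α i ∘ₗ incl α from LinearMap.congr_fun h v
  refine Finsupp.lhom_ext' fun T => LinearMap.ext_ring ?_
  have h2 : ∀ U : SIT α, incl α (V.basisVec U) = Finsupp.single U.entry 1 :=
    fun _ => Finsupp.mapDomain_single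
  change incl α (act α i (V.basisVec T)) = fillAct α i (incl α (V.basisVec T))
  rw [act_basisVec, h2]
  simp only [fillAct, Finsupp.linearCombination_single, one_smul, actBasis, fillBasis]
  split_ifs with hd hc
  · simp
  · rw [h2]; rfl
  · rw [h2]

theorem fillAct_single {n : ℕ} {α : Composition n} (i : Fin (n - 1)) (T : Filling α) :
    fillAct α i (Finsupp.single T 1) = fillBasis i T := by
  simp [fillAct]

theorem swapEntries_symm {n : ℕ} {α : Composition n} (i : Fin (n - 1)) (T : Filling α)
    (x : Fin n) :
    (swapEntries i T).symm x = T.symm (Equiv.swap (lo i) (hi i) x) := by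
  simp [swapEntries]

theorem lo_ne_hi {n : ℕ} (i : Fin (n - 1)) : lo i ≠ hi i := by
  simp [lo, hi, Fin.ext_iff]

theorem fillAct_idem {n : ℕ} (α : Composition n) (i : Fin (n - 1)) :
    fillAct α i * fillAct α i = fillAct α i := by
  refine Finsupp.lhom_ext' fun T => LinearMap.ext_ring ?_
  change fillAct α i (fillAct α i (Finsupp.single T 1)) = fillAct α i (Finsupp.single T 1)
  by_cases hd : IsDescent i T
  · by_cases hc : BothFirstColumn i T
    · simp [fillAct_single, fillBasis, hd, hc]
    · have hd' : ¬IsDescent i (swapEntries i T) := by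
        simp only [IsDescent, swapEntries_symm, Equiv.swap_apply_left, Equiv.swap_apply_right,
          not_lt]
        exact le_of_lt hd
      simp [fillAct_single, fillBasis, hd, hc, hd']
  · simp [fillAct_single, fillBasis, hd]

theorem fillAct_comm {n : ℕ} (α : Composition n) (i j : Fin (n - 1)) (h : (i : ℕ) + 2 ≤ j) :
    fillAct α i * fillAct α j = fillAct α j * fillAct α i := by
  refine Finsupp.lhom_ext' fun T => LinearMap.ext_ring ?_
  change fillAct α i (fillAct α j (Finsupp.single T 1)) =
    fillAct α j (fillAct α i (Finsupp.single T 1))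
  have n1 : lo i ≠ lo j := by simp [lo, Fin.ext_iff]; omega
  have n2 : lo i ≠ hi j := by simp [lo, hi, Fin.ext_iff]; omega
  have n3 : hi i ≠ lo j := by simp [lo, hi, Fin.ext_iff]; omega
  have n4 : hi i ≠ hi j := by simp [hi, Fin.ext_iff]; omega
  have d1 : IsDescent i (swapEntries j T) ↔ IsDescent i T := by
    simp only [IsDescent, swapEntries_symm, Equiv.swap_apply_of_ne_of_ne n1 n2,
      Equiv.swap_apply_of_ne_of_ne n3 n4]
  have d2 : IsDescent j (swapEntries i T) ↔ IsDescent j T := by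
    simp only [IsDescent, swapEntries_symm, Equiv.swap_apply_of_ne_of_ne n1.symm n3.symm,
      Equiv.swap_apply_of_ne_of_ne n2.symm n4.symm]
  have c1 : BothFirstColumn i (swapEntries j T) ↔ BothFirstColumn i T := by
    simp only [BothFirstColumn, swapEntries_symm, Equiv.swap_apply_of_ne_of_ne n1 n2,
      Equiv.swap_apply_of_ne_of_ne n3 n4]
  have c2 : BothFirstColumn j (swapEntries i T) ↔ BothFirstColumn j T := by
    simp only [BothFirstColumn, swapEntries_symm, Equiv.swap_apply_of_ne_of_ne n1.symm n3.symm,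
      Equiv.swap_apply_of_ne_of_ne n2.symm n4.symm]
  have hs : swapEntries i (swapEntries j T) = swapEntries j (swapEntries i T) := by
    refine Equiv.ext fun x => ?_
    simp only [swapEntries, Equiv.trans_apply, Equiv.swap_apply_def]
    split_ifs <;> simp_all
  by_cases hdi : IsDescent i T <;> by_cases hdj : IsDescent j T <;>
    by_cases hci : BothFirstColumn i T <;> by_cases hcj : BothFirstColumn j T <;>
    simp [fillAct_single, fillBasis, hdi, hdj, hci, hcj, d1, d2, c1, c2, hs]

set_option maxHeartbeats 1000000 in
theorem fillAct_braid {n : ℕ} (α : Composition n) (i j : Fin (n - 1)) (h : (i : ℕ) + 1 = j) :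
    fillAct α i * fillAct α j * fillAct α i = fillAct α j * fillAct α i * fillAct α j := by
  refine Finsupp.lhom_ext' fun T => LinearMap.ext_ring ?_
  change fillAct α i (fillAct α j (fillAct α i (Finsupp.single T 1))) =
    fillAct α j (fillAct α i (fillAct α j (Finsupp.single T 1)))
  have hij : hi i = lo j := by simp [lo, hi, h]
  have n1 : lo i ≠ lo j := by simp [lo, Fin.ext_iff]; omega
  have n2 : lo i ≠ hi j := by simp [lo, hi, Fin.ext_iff]; omega
  have n3 : lo j ≠ hi j := lo_ne_hi j
  have hs : swapEntries i (swapEntries j (swapEntries i T)) =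
      swapEntries j (swapEntries i (swapEntries j T)) := by
    refine Equiv.ext fun x => ?_
    simp only [swapEntries, Equiv.trans_apply, Equiv.swap_apply_def, hij]
    split_ifs <;> simp_all
  have s1 : Equiv.swap (lo i) (lo j) (hi j) = hi j :=
    Equiv.swap_apply_of_ne_of_ne n2.symm n3.symm
  have s2 : Equiv.swap (lo j) (hi j) (lo i) = lo i := Equiv.swap_apply_of_ne_of_ne n1 n2
  have e1 : ∀ U : Filling α, fillAct α i (Finsupp.single U 1) =
      if row (U.symm (lo i)) < row (U.symm (lo j)) then
        if col (U.symm (lo i)) = 0 ∧ col (U.symm (lo j)) = 0 then 0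
        else Finsupp.single (swapEntries i U) 1
      else Finsupp.single U 1 := fun U => by
    rw [fillAct_single, fillBasis, ← hij]
    rfl
  have e2 : ∀ U : Filling α, fillAct α j (Finsupp.single U 1) =
      if row (U.symm (lo j)) < row (U.symm (hi j)) then
        if col (U.symm (lo j)) = 0 ∧ col (U.symm (hi j)) = 0 then 0
        else Finsupp.single (swapEntries j U) 1
      else Finsupp.single U 1 := fun U => by
    rw [fillAct_single, fillBasis]
    rfl
  have ti1 : ∀ U : Filling α, (swapEntries i U).symm (lo i) = U.symm (lo j) := fun U => by
    rw [swapEntries_symm, hij, Equiv.swap_apply_left]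
  have ti2 : ∀ U : Filling α, (swapEntries i U).symm (lo j) = U.symm (lo i) := fun U => by
    rw [swapEntries_symm, hij, Equiv.swap_apply_right]
  have ti3 : ∀ U : Filling α, (swapEntries i U).symm (hi j) = U.symm (hi j) := fun U => by
    rw [swapEntries_symm, hij, s1]
  have tj1 : ∀ U : Filling α, (swapEntries j U).symm (lo i) = U.symm (lo i) := fun U => by
    rw [swapEntries_symm, s2]
  have tj2 : ∀ U : Filling α, (swapEntries j U).symm (lo j) = U.symm (hi j) := fun U => by
    rw [swapEntries_symm, Equiv.swap_apply_left]
  have tj3 : ∀ U : Filling α, (swapEntries j U).symm (hi j) = U.symm (lo j) := fun U => by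
    rw [swapEntries_symm, Equiv.swap_apply_right]
  by_cases hab : row (T.symm (lo i)) < row (T.symm (lo j)) <;>
  by_cases hbc : row (T.symm (lo j)) < row (T.symm (hi j)) <;>
  by_cases hac : row (T.symm (lo i)) < row (T.symm (hi j)) <;>
  first
  | (exfalso; omega)
  | (by_cases ha : col (T.symm (lo i)) = 0 <;> by_cases hb : col (T.symm (lo j)) = 0 <;>
      by_cases hc : col (T.symm (hi j)) = 0 <;>
      simp only [e1, e2, ti1, ti2, ti3, tj1, tj2, tj3, hab, hbc, hac, ha, hb, hc, hs, if_true,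
        if_false, and_true, and_false, and_self, map_zero] <;>
      first
      | rw [if_neg hab.not_gt]
      | rw [if_neg hbc.not_gt])

/-- The action of `H_n(0)` on `V α`, as a representation. -/
def rep {n : ℕ} (α : Composition n) : H n →ₐ[ℂ] Module.End ℂ (V α) :=
  RingQuot.liftAlgHom ℂ ⟨FreeAlgebra.lift ℂ (act α), by
    intro x y hxy
    refine LinearMap.ext fun v => incl_injective α ?_
    cases hxy with
    | idem i =>
      have := LinearMap.congr_fun (fillAct_idem α i) (incl α v)
      simpa [incl_act] using this
    | braid i j h =>
      have := LinearMap.congr_fun (fillAct_braid α i j h) (incl α v)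
      simpa [incl_act] using this
    | comm i j h =>
      have := LinearMap.congr_fun (fillAct_comm α i j h) (incl α v)
      simpa [incl_act] using this⟩

instance {n : ℕ} (α : Composition n) : Module (H n) (V α) :=
  Module.compHom (V α) (rep α).toRingHom

instance {n : ℕ} (α : Composition n) : IsScalarTower ℂ (H n) (V α) where
  smul_assoc c x v := by
    change rep α (c • x) v = c • rep α x v
    rw [map_smul]
    rfl

/-- The generators of `H_n(0)` act on tableaux by the formula `actBasis`. -/
theorem gen_smul_basisVec {n : ℕ} {α : Composition n} (i : Fin (n - 1)) (T : SIT α) :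
    gen i • V.basisVec T = actBasis i T := by
  change rep α (gen i) (V.basisVec T) = _
  rw [← act_basisVec]
  simp [rep, gen]

/-! ### Projective covers and essential rigidity -/

/-- An essential epimorphism: a surjective homomorphism `f : A → B` such that every homomorphism
`g : X → A` with `f ∘ g` surjective is surjective. -/
def IsEssentialEpi {R : Type} [Ring R] {A B : Type} [AddCommGroup A] [Module R A]
    [AddCommGroup B] [Module R B] (f : A →ₗ[R] B) : Prop :=
  Function.Surjective f ∧
    ∀ (X : Type) [AddCommGroup X] [Module R X] (g : X →ₗ[R] A),
      Function.Surjective (f ∘ₗ g) → Function.Surjective g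

/-- A projective cover: an essential epimorphism from a projective module. -/
def IsProjectiveCover {R : Type} [Ring R] {P A : Type} [AddCommGroup P] [Module R P]
    [AddCommGroup A] [Module R A] (f : P →ₗ[R] A) : Prop :=
  Module.Projective R P ∧ IsEssentialEpi f

/-- `M` is essentially rigid if `Hom(Ω(M), M) = 0`, where the syzygy module `Ω(M)` is the kernel of
a projective cover of `M`. Since projective covers are unique up to isomorphism, this is required
to hold for every one of them; that there is one is a part of the definition. -/
def IsEssentiallyRigid (R : Type) [Ring R] (M : Type) [AddCommGroup M] [Module R M] : Prop :=
  (∃ (P : Type) (_ : AddCommGroup P) (_ : Module R P) (f : P →ₗ[R] M), IsProjectiveCover f) ∧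
    ∀ (P : Type) [AddCommGroup P] [Module R P] (f : P →ₗ[R] M), IsProjectiveCover f →
      ∀ g : LinearMap.ker f →ₗ[R] M, g = 0

end ZeroHecke

end

/-!
The module `V α` is generated by the source tableau, and everything is controlled by the positions
of the generators that fix a vector.

A tableau is recorded by its row word, a rearrangement of the sorted word of content `α`. In any
`H_n(0)`-module, a vector `x` that is fixed by `π_i` at the equal neighbours of the sorted word can
be moved along all rearrangements; the result `wordAct x w` does not depend on the way
(`wordAct_of_descent`), and these vectors span the submodule generated by `x`
(`smul_mem_span_wordAct`). Applied to the regular module, this shows that `H_n(0)` is finite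
dimensional and gives the element of a parabolic subalgebra that projects to its fixed vectors
(`exists_parabolic_absorber`).

In `V β` a vector fixed by `π_i` is supported on tableaux without the descent `i`. A tableau of
shape `β` whose descents are all descents of the source tableau of shape `α` forces `β` to dominate
`α` (`SIT.le_sizeUpTo`), so for `β ≤_l α` it is the source tableau of shape `α = β`. Hence a
homomorphism from `V α` to `V β`, or an endomorphism of a quotient of `V α`, sends the generator to
a multiple of the generator or to zero. For quotients the parabolic element lifts the fixed vector
to `V α`.

For the syzygy, let `P → V α` be a projective cover, and `x` a lift of the source tableau that is
fixed by the same generators. The kernel is spanned by the vectors `wordAct x w` with `w` not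
standard. The extremal ones among these words arise from the sorted word by moving one letter `j + 1`
to the left of all letters `j`; the corresponding vectors are fixed like a source tableau whose
shape is lexicographically larger than `α`, so every homomorphism to `V β` with `β ≤_l α` kills them
(`eq_zero_of_not_isStdWord`, `hom_ker_eq_zero`). This is essential rigidity for `β = α`, and by the
long exact sequence it gives the vanishing of `Ext¹`.
-/

namespace ZeroHecke

/-! ### Relations in the 0-Hecke algebra -/

theorem gen_mul_self {n : ℕ} (i : Fin (n - 1)) : gen i * gen i = gen i := by
  simpa [gen] using RingQuot.mkAlgHom_rel ℂ (Rel.idem i)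

theorem gen_braid {n : ℕ} (i j : Fin (n - 1)) (h : (i : ℕ) + 1 = j) :
    gen i * gen j * gen i = gen j * gen i * gen j := by
  simpa [gen] using RingQuot.mkAlgHom_rel ℂ (Rel.braid i j h)

theorem gen_comm {n : ℕ} (i j : Fin (n - 1)) (h : (i : ℕ) + 2 ≤ j) :
    gen i * gen j = gen j * gen i := by
  simpa [gen] using RingQuot.mkAlgHom_rel ℂ (Rel.comm i j h)

/-- Induction over the 0-Hecke algebra: a `ℂ`-subspace of a module that is stable under the
generators is stable under the whole algebra. -/
theorem smul_mem_of_gen_smul_mem {n : ℕ} {X : Type*} [AddCommGroup X] [Module (H n) X]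
    [Module ℂ X] [IsScalarTower ℂ (H n) X] (S : Submodule ℂ X)
    (hS : ∀ (i : Fin (n - 1)), ∀ s ∈ S, gen i • s ∈ S) (h : H n) {s : X} (hs : s ∈ S) :
    h • s ∈ S := by
  obtain ⟨a, rfl⟩ := RingQuot.mkAlgHom_surjective ℂ (Rel n) h
  induction a using FreeAlgebra.induction generalizing s with
  | grade0 c =>
    rw [AlgHom.commutes, algebraMap_smul]
    exact S.smul_mem c hs
  | grade1 i => exact hS i s hs
  | mul a b ha hb =>
    rw [map_mul, mul_smul]
    exact ha (hb hs)
  | add a b ha hb =>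
    rw [map_add, add_smul]
    exact S.add_mem (ha hs) (hb hs)

/-! ### Words and their inversions -/

/-- The transposition of the positions `i` and `i + 1`. -/
abbrev sw {n : ℕ} (i : Fin (n - 1)) : Equiv.Perm (Fin n) := Equiv.swap (lo i) (hi i)

theorem sw_sw {n : ℕ} (i : Fin (n - 1)) (m : Fin n) : sw i (sw i m) = m :=
  Equiv.swap_apply_self _ _ _

theorem comp_sw_comp_sw {n : ℕ} {A : Type*} (w : Fin n → A) (i : Fin (n - 1)) :
    (w ∘ sw i) ∘ sw i = w := by
  funext m
  simp

theorem lo_lt_hi {n : ℕ} (i : Fin (n - 1)) : lo i < hi i := by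
  simp [lo, hi, Fin.lt_def]

/-- The number of inversions of a word. -/
def inv {n : ℕ} (w : Fin n → ℕ) : ℕ :=
  (Finset.univ.filter fun p : Fin n × Fin n => p.1 < p.2 ∧ w p.2 < w p.1).card

theorem inv_comp_sw_lt {n : ℕ} (w : Fin n → ℕ) (i : Fin (n - 1)) (h : w (hi i) < w (lo i)) :
    inv (w ∘ sw i) < inv w := by
  unfold inv
  rw [← Finset.card_map (((sw i).prodCongr (sw i)).toEmbedding)]
  refine Finset.card_lt_card ((Finset.ssubset_iff_of_subset ?_).2 ⟨(lo i, hi i), ?_, ?_⟩)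
  · intro p hp
    simp only [Finset.mem_map, Finset.mem_filter, Finset.mem_univ, true_and] at hp ⊢
    obtain ⟨⟨a, b⟩, ⟨hab, hw⟩, rfl⟩ := hp
    refine ⟨swap_lt_swap i hab ?_, hw⟩
    rintro ⟨rfl, rfl⟩
    simp only [Function.comp, Equiv.swap_apply_left, Equiv.swap_apply_right] at hw
    omega
  · simpa using ⟨lo_lt_hi i, h⟩
  · simp only [Finset.mem_map, Finset.mem_filter, Finset.mem_univ, true_and]
    rintro ⟨⟨a, b⟩, ⟨hab, -⟩, h2⟩
    obtain ⟨h3, h4⟩ := Prod.ext_iff.1 h2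
    have ea : a = hi i := by rw [← sw_sw i a]; exact (congrArg (sw i) h3).trans (by simp)
    have eb : b = lo i := by rw [← sw_sw i b]; exact (congrArg (sw i) h4).trans (by simp)
    subst ea eb
    exact absurd hab (lo_lt_hi i).not_gt

/-- A word without descents between two positions does not decrease from one to the other. -/
theorem le_of_no_descent {n : ℕ} (w : Fin n → ℕ) {a b : Fin n} (hab : a ≤ b)
    (h : ∀ i : Fin (n - 1), a ≤ lo i → hi i ≤ b → w (lo i) ≤ w (hi i)) : w a ≤ w b := by
  obtain ⟨b, hb⟩ := b
  change (a : ℕ) ≤ b at hab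
  induction b, hab using Nat.le_induction with
  | base => exact le_rfl
  | succ b hab ih =>
    refine (ih (by omega) fun i h1 h2 => h i h1 (h2.trans (by simp [Fin.le_def]))).trans ?_
    exact h ⟨b, by omega⟩ (by simpa [lo, Fin.le_def] using hab) (by simp [hi])

/-- The words that are rearrangements of a given word. -/
def IsRearr {n : ℕ} (w₀ w : Fin n → ℕ) : Prop := ∃ σ : Equiv.Perm (Fin n), w = w₀ ∘ σ

theorem IsRearr.refl {n : ℕ} (w₀ : Fin n → ℕ) : IsRearr w₀ w₀ := ⟨1, rfl⟩

theorem IsRearr.comp_sw {n : ℕ} {w₀ w : Fin n → ℕ} (h : IsRearr w₀ w) (i : Fin (n - 1)) :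
    IsRearr w₀ (w ∘ sw i) := by
  obtain ⟨σ, rfl⟩ := h
  exact ⟨(sw i).trans σ, rfl⟩

theorem IsRearr.eq_of_monotone {n : ℕ} {w₀ w : Fin n → ℕ} (h₀ : Monotone w₀)
    (h : IsRearr w₀ w) (hw : ∀ i : Fin (n - 1), w (lo i) ≤ w (hi i)) : w = w₀ := by
  obtain ⟨σ, rfl⟩ := h
  have hm : Monotone (w₀ ∘ σ) := fun a b hab => le_of_no_descent _ hab fun i _ _ => hw i
  exact Tuple.unique_monotone (τ := 1) hm (by simpa using h₀)

/-- Every rearrangement of a sorted word is reached from it by swapping ascents. -/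
theorem IsRearr.induction {n : ℕ} {w₀ : Fin n → ℕ} (h₀ : Monotone w₀)
    {Q : (Fin n → ℕ) → Prop} (base : Q w₀)
    (step : ∀ w, IsRearr w₀ w → ∀ i : Fin (n - 1), w (lo i) < w (hi i) → Q w → Q (w ∘ sw i))
    {w : Fin n → ℕ} (hw : IsRearr w₀ w) : Q w := by
  induction hN : inv w using Nat.strong_induction_on generalizing w with
  | _ N ih =>
    by_cases hd : ∃ i : Fin (n - 1), w (hi i) < w (lo i)
    · obtain ⟨i, hi'⟩ := hd
      have := step (w ∘ sw i) (hw.comp_sw i) i (by simpa using hi')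
        (ih _ (hN ▸ inv_comp_sw_lt w i hi') (hw.comp_sw i) rfl)
      rwa [comp_sw_comp_sw] at this
    · push Not at hd
      rwa [hw.eq_of_monotone h₀ hd]

/-! ### The action of the 0-Hecke algebra along words -/

section WordAct

variable {n : ℕ} {X : Type*} [AddCommGroup X] [Module (H n) X]

open Classical in
/-- The vector reached from `x` by sorting the word `w`: as long as `w` has a descent `i`, the
generator `π_i` is applied and `w` is replaced by `w ∘ s_i`. The choice of the descents does not
matter, see `wordAct_of_descent`. -/
noncomputable def wordAct (x : X) (w : Fin n → ℕ) : X :=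
  if h : ∃ i : Fin (n - 1), w (hi i) < w (lo i) then
    gen h.choose • wordAct x (w ∘ sw h.choose)
  else x
termination_by inv w
decreasing_by exact inv_comp_sw_lt w _ h.choose_spec

theorem wordAct_of_sorted (x : X) {w : Fin n → ℕ} (hw : ∀ i : Fin (n - 1), w (lo i) ≤ w (hi i)) :
    wordAct x w = x := by
  rw [wordAct, dif_neg]
  push Not
  exact hw

theorem wordAct_diamond_aux (x : X) (w : Fin n → ℕ)
    (ih : ∀ w' : Fin n → ℕ, inv w' < inv w → ∀ i : Fin (n - 1), w' (hi i) < w' (lo i) →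
      wordAct x w' = gen i • wordAct x (w' ∘ sw i))
    (i j : Fin (n - 1)) (hij : i < j) (hdi : w (hi i) < w (lo i)) (hdj : w (hi j) < w (lo j)) :
    gen i • wordAct x (w ∘ sw i) = gen j • wordAct x (w ∘ sw j) := by
  have li := inv_comp_sw_lt w i hdi
  have lj := inv_comp_sw_lt w j hdj
  have n1 : lo i ≠ lo j := by simp [lo, Fin.ext_iff]; omega
  have n2 : lo i ≠ hi j := by simp [lo, hi, Fin.ext_iff]; omega
  have n3 : hi i ≠ hi j := by simp [hi, Fin.ext_iff]; omega
  have n4 : lo j ≠ hi j := lo_ne_hi j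
  have n5 : lo i ≠ hi i := lo_ne_hi i
  by_cases hadj : (i : ℕ) + 1 = j
  · have e : hi i = lo j := by simp [lo, hi, hadj]
    have s1 : sw i (lo i) = lo j := by rw [← e]; exact Equiv.swap_apply_left _ _
    have s2 : sw i (lo j) = lo i := by rw [← e]; exact Equiv.swap_apply_right _ _
    have s3 : sw i (hi j) = hi j := Equiv.swap_apply_of_ne_of_ne n2.symm n3.symm
    have t1 : sw j (lo i) = lo i := Equiv.swap_apply_of_ne_of_ne n1 n2
    have t2 : sw j (lo j) = hi j := Equiv.swap_apply_left _ _
    have t3 : sw j (hi j) = lo j := Equiv.swap_apply_right _ _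
    rw [e] at hdi
    have d1 : (w ∘ sw i) (hi j) < (w ∘ sw i) (lo j) := by simp only [Function.comp, s2, s3]; omega
    have d2 : (w ∘ sw j) (hi i) < (w ∘ sw j) (lo i) := by
      simp only [e, Function.comp, t1, t2]; omega
    have l1 := inv_comp_sw_lt _ j d1
    have l2 := inv_comp_sw_lt _ i d2
    rw [ih _ li j d1, ih _ lj i d2,
      ih _ (l1.trans li) i (by simp only [e, Function.comp, t1, t2, s1, s3]; omega),
      ih _ (l2.trans lj) j (by simp only [Function.comp, t1, t3, s2, s3]; omega)]
    simp only [← mul_smul]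
    rw [← mul_assoc, ← mul_assoc, gen_braid i j hadj]
    congr 2
    funext m
    simp only [Function.comp]
    congr 1
    change (sw i * sw j * sw i) m = (sw j * sw i * sw j) m
    congr 1
    simp only [sw, e]
    rw [Equiv.swap_mul_swap_mul_swap n1 n2, Equiv.swap_comm (lo i) (lo j),
      Equiv.swap_comm (lo j) (hi j), Equiv.swap_mul_swap_mul_swap n4.symm n2.symm,
      Equiv.swap_comm]
  · have n6 : hi i ≠ lo j := by simp [lo, hi, Fin.ext_iff]; omega
    have s2 : sw i (lo j) = lo j := Equiv.swap_apply_of_ne_of_ne n1.symm n6.symm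
    have s3 : sw i (hi j) = hi j := Equiv.swap_apply_of_ne_of_ne n2.symm n3.symm
    have t1 : sw j (lo i) = lo i := Equiv.swap_apply_of_ne_of_ne n1 n2
    have t2 : sw j (hi i) = hi i := Equiv.swap_apply_of_ne_of_ne n6 n3
    rw [ih _ li j (by simpa only [Function.comp, s2, s3] using hdj),
      ih _ lj i (by simpa only [Function.comp, t1, t2] using hdi), ← mul_smul, ← mul_smul,
      gen_comm i j (by omega)]
    congr 2
    funext m
    simp only [Function.comp]
    congr 1
    change (sw i * sw j) m = (sw j * sw i) m
    congr 1
    exact Equiv.Perm.Disjoint.commute (Equiv.Perm.disjoint_swap_swap (by simp; tauto))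

/-- Any descent of a word may be taken as the first one to be sorted. By induction on the number
of inversions this is local confluence: two descents that are not adjacent use the commutation
relation, two adjacent ones the braid relation. -/
theorem wordAct_of_descent (x : X) (w : Fin n → ℕ) (i : Fin (n - 1)) (h : w (hi i) < w (lo i)) :
    wordAct x w = gen i • wordAct x (w ∘ sw i) := by
  induction hN : inv w using Nat.strong_induction_on generalizing w i with
  | _ N ih =>
    subst hN
    have hex : ∃ i : Fin (n - 1), w (hi i) < w (lo i) := ⟨i, h⟩
    have key : wordAct x w = gen hex.choose • wordAct x (w ∘ sw hex.choose) := by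
      rw [wordAct, dif_pos hex]
    rw [key]
    have hj := hex.choose_spec
    generalize hex.choose = j at hj
    have ih' : ∀ w' : Fin n → ℕ, inv w' < inv w → ∀ i : Fin (n - 1), w' (hi i) < w' (lo i) →
      wordAct x w' = gen i • wordAct x (w' ∘ sw i) := fun w' hw' i hi' => ih _ hw' w' i hi' rfl
    rcases lt_trichotomy i j with hlt | rfl | hlt
    · exact (wordAct_diamond_aux x w ih' i j hlt h hj).symm
    · rfl
    · exact wordAct_diamond_aux x w ih' j i hlt hj h

theorem gen_smul_wordAct_of_lt (x : X) {w : Fin n → ℕ} {i : Fin (n - 1)}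
    (h : w (lo i) < w (hi i)) : gen i • wordAct x w = wordAct x (w ∘ sw i) := by
  rw [wordAct_of_descent x (w ∘ sw i) i (by simpa using h), comp_sw_comp_sw]

theorem gen_smul_wordAct_of_gt (x : X) {w : Fin n → ℕ} {i : Fin (n - 1)}
    (h : w (hi i) < w (lo i)) : gen i • wordAct x w = wordAct x w := by
  rw [wordAct_of_descent x w i h, ← mul_smul, gen_mul_self]

/-- If `x` is fixed by `π_i` whenever the letters `i` and `i + 1` of the sorted word agree, then
the same holds for all vectors reached from `x`. -/
theorem gen_smul_wordAct_of_eq (x : X) {w₀ : Fin n → ℕ} (h₀ : Monotone w₀)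
    (hx : ∀ i : Fin (n - 1), w₀ (lo i) = w₀ (hi i) → gen i • x = x)
    {w : Fin n → ℕ} (hw : IsRearr w₀ w) {i : Fin (n - 1)} (h : w (lo i) = w (hi i)) :
    gen i • wordAct x w = wordAct x w := by
  induction hN : inv w using Nat.strong_induction_on generalizing w i with
  | _ N ih =>
    subst hN
    by_cases hd : ∃ j : Fin (n - 1), w (hi j) < w (lo j)
    · obtain ⟨j, hj⟩ := hd
      have lj := inv_comp_sw_lt w j hj
      have hne : i ≠ j := by rintro rfl; omega
      have n1 : lo i ≠ lo j := by simpa [lo, Fin.ext_iff] using hne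
      have n2 : hi i ≠ hi j := by simpa [hi, Fin.ext_iff] using hne
      by_cases c1 : (i : ℕ) + 1 = j
      · have e : hi i = lo j := by simp [lo, hi, c1]
        have n3 : lo i ≠ hi j := by simp [lo, hi, Fin.ext_iff]; omega
        have s2 : sw i (lo j) = lo i := by rw [← e]; exact Equiv.swap_apply_right _ _
        have s3 : sw i (hi j) = hi j := Equiv.swap_apply_of_ne_of_ne n3.symm n2.symm
        have t1 : sw j (lo i) = lo i := Equiv.swap_apply_of_ne_of_ne n1 n3
        have t2 : sw j (lo j) = hi j := Equiv.swap_apply_left _ _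
        have t3 : sw j (hi j) = lo j := Equiv.swap_apply_right _ _
        rw [e] at h
        have d2 : (w ∘ sw j) (hi i) < (w ∘ sw j) (lo i) := by
          simp only [e, Function.comp, t1, t2]; omega
        have l2 := inv_comp_sw_lt _ i d2
        have fx : gen j • wordAct x ((w ∘ sw j) ∘ sw i) = wordAct x ((w ∘ sw j) ∘ sw i) :=
          ih _ (l2.trans lj) ((hw.comp_sw j).comp_sw i)
            (by simp only [Function.comp, t1, t3, s2, s3]; omega) rfl
        rw [wordAct_of_descent x w j hj, wordAct_of_descent x _ i d2, ← mul_smul, ← mul_smul,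
          gen_braid i j c1, mul_smul, fx, mul_smul]
      · by_cases c2 : (j : ℕ) + 1 = i
        · have e : hi j = lo i := by simp [lo, hi, c2]
          have n3 : lo j ≠ hi i := by simp [lo, hi, Fin.ext_iff]; omega
          have s1 : sw j (lo j) = lo i := by rw [← e]; exact Equiv.swap_apply_left _ _
          have s2 : sw j (lo i) = lo j := by rw [← e]; exact Equiv.swap_apply_right _ _
          have s3 : sw j (hi i) = hi i := Equiv.swap_apply_of_ne_of_ne n3.symm n2
          have t1 : sw i (lo j) = lo j := Equiv.swap_apply_of_ne_of_ne n1.symm n3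
          have t2 : sw i (lo i) = hi i := Equiv.swap_apply_left _ _
          have t3 : sw i (hi i) = lo i := Equiv.swap_apply_right _ _
          rw [e] at hj
          have d2 : (w ∘ sw j) (hi i) < (w ∘ sw j) (lo i) := by
            simp only [Function.comp, s2, s3]; omega
          have l2 := inv_comp_sw_lt _ i d2
          have fx : gen j • wordAct x ((w ∘ sw j) ∘ sw i) = wordAct x ((w ∘ sw j) ∘ sw i) :=
            ih _ (l2.trans lj) ((hw.comp_sw j).comp_sw i)
              (by simp only [e, Function.comp, t1, t2, s1, s3]; omega) rfl
          rw [wordAct_of_descent x w j (by rwa [e]), wordAct_of_descent x _ i d2, ← mul_smul,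
            ← mul_smul, ← gen_braid j i c2, mul_smul, fx, mul_smul]
        · have n3 : lo i ≠ hi j := by simp [lo, hi, Fin.ext_iff]; omega
          have n4 : hi i ≠ lo j := by simp [lo, hi, Fin.ext_iff]; omega
          have t1 : sw j (lo i) = lo i := Equiv.swap_apply_of_ne_of_ne n1 n3
          have t2 : sw j (hi i) = hi i := Equiv.swap_apply_of_ne_of_ne n4 n2
          have hc : gen i * gen j = gen j * gen i := by
            rcases lt_or_gt_of_ne hne with hlt | hlt
            · exact gen_comm i j (by omega)
            · exact (gen_comm j i (by omega)).symm
          rw [wordAct_of_descent x w j hj, ← mul_smul, hc, mul_smul,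
            ih _ lj (hw.comp_sw j) (by simpa only [Function.comp, t1, t2] using h) rfl]
    · push Not at hd
      obtain rfl := hw.eq_of_monotone h₀ hd
      rw [wordAct_of_sorted x hd]
      exact hx i h

/-- The span of the vectors reached from `x` is an `H_n(0)`-submodule. -/
theorem smul_mem_span_wordAct [Module ℂ X] [IsScalarTower ℂ (H n) X] (x : X) {w₀ : Fin n → ℕ}
    (h₀ : Monotone w₀) (hx : ∀ i : Fin (n - 1), w₀ (lo i) = w₀ (hi i) → gen i • x = x) (h : H n) :
    h • x ∈ Submodule.span ℂ (wordAct x '' {w | IsRearr w₀ w}) := by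
  refine smul_mem_of_gen_smul_mem _ (fun i s hs => ?_) h (Submodule.subset_span
    ⟨w₀, .refl w₀, wordAct_of_sorted x fun i => h₀ (lo_lt_hi i).le⟩)
  induction hs using Submodule.span_induction with
  | mem y hy =>
    obtain ⟨w, hw, rfl⟩ := hy
    rcases lt_trichotomy (w (lo i)) (w (hi i)) with hlt | heq | hgt
    · rw [gen_smul_wordAct_of_lt x hlt]
      exact Submodule.subset_span ⟨_, hw.comp_sw i, rfl⟩
    · rw [gen_smul_wordAct_of_eq x h₀ hx hw heq]
      exact Submodule.subset_span ⟨_, hw, rfl⟩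
    · rw [gen_smul_wordAct_of_gt x hgt]
      exact Submodule.subset_span ⟨_, hw, rfl⟩
  | zero => rw [smul_zero]; exact Submodule.zero_mem _
  | add y z _ _ hy hz => rw [smul_add]; exact Submodule.add_mem _ hy hz
  | smul c y _ hy =>
    have : gen i • c • y = c • gen i • y := by
      rw [← algebraMap_smul (H n) c y, ← mul_smul, ← Algebra.commutes, mul_smul, algebraMap_smul]
    rw [this]
    exact Submodule.smul_mem _ c hy

end WordAct

/-- The 0-Hecke algebra is finite dimensional: it is spanned by the vectors reached from `1`
along the permutations. -/
instance finite_H (n : ℕ) : Module.Finite ℂ (H n) := by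
  have hm : StrictMono (fun m : Fin n => (m : ℕ)) := fun a b h => h
  refine ⟨(Submodule.fg_def).2 ⟨wordAct (1 : H n) '' {w | IsRearr (fun m : Fin n => (m : ℕ)) w},
    Set.Finite.image _ ?_, ?_⟩⟩
  · refine (Set.finite_range
      fun σ : Equiv.Perm (Fin n) => (fun m : Fin n => (m : ℕ)) ∘ σ).subset ?_
    rintro w ⟨σ, rfl⟩
    exact ⟨σ, rfl⟩
  · refine eq_top_iff.2 fun h _ => ?_
    have := smul_mem_span_wordAct (1 : H n) hm.monotone
      (fun i hi' => absurd hi' (hm (lo_lt_hi i)).ne) h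
    rwa [smul_eq_mul, mul_one] at this

/-- For every parabolic subalgebra, generated by the `π_i` for which the letters `i` and `i + 1`
of a sorted word agree, there is an element of the subalgebra that absorbs these `π_i` from the
left; as a member of the subalgebra it fixes every vector that they all fix. It is the product
along the longest element of the parabolic subgroup. -/
theorem exists_parabolic_absorber {n : ℕ} {w₀ : Fin n → ℕ} (h₀ : Monotone w₀) :
    ∃ p : H n, (∀ i : Fin (n - 1), w₀ (lo i) = w₀ (hi i) → gen i * p = p) ∧
      ∀ (X : Type) [AddCommGroup X] [Module (H n) X] (x : X),
        (∀ i : Fin (n - 1), w₀ (lo i) = w₀ (hi i) → gen i • x = x) → p • x = x := by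
  -- this word is injective, and its inversions are the pairs with equal letters in `w₀`
  let w : Fin n → ℕ := fun m => w₀ m * n + (n - 1 - m)
  refine ⟨wordAct 1 w, fun i hi' =>
    (smul_eq_mul _ _).symm.trans (gen_smul_wordAct_of_gt 1 ?_), ?_⟩
  · have := (hi i).2
    simp only [w, hi']
    simp only [lo, hi] at this ⊢
    omega
  · intro X _ _ x hx
    have key : ∀ v : Fin n → ℕ, (∀ a b, a < b → v b < v a → w₀ a = w₀ b) →
        wordAct (1 : H n) v • x = x := by
      intro v hv
      induction hN : inv v using Nat.strong_induction_on generalizing v with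
      | _ N ih =>
        subst hN
        by_cases hd : ∃ i : Fin (n - 1), v (hi i) < v (lo i)
        · obtain ⟨i, hd⟩ := hd
          have e : w₀ (lo i) = w₀ (hi i) := hv _ _ (lo_lt_hi i) hd
          have hsw : ∀ m, w₀ (sw i m) = w₀ m := fun m => by
            rw [sw, Equiv.swap_apply_def]
            split_ifs with h1 h2
            · rw [h1, e]
            · rw [h2, e]
            · rfl
          rw [wordAct_of_descent 1 v i hd, smul_eq_mul, mul_smul,
            ih _ (inv_comp_sw_lt v i hd) _ ?_ rfl, hx i e]
          intro a b hab hlt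
          rw [← hsw a, ← hsw b]
          refine hv _ _ (swap_lt_swap i hab ?_) hlt
          rintro ⟨rfl, rfl⟩
          simp only [Function.comp, Equiv.swap_apply_left, Equiv.swap_apply_right] at hlt
          omega
        · push Not at hd
          rw [wordAct_of_sorted _ hd, one_smul]
    refine key w fun a b hab hlt => (h₀ hab.le).antisymm ?_
    by_contra hc
    push Not at hc
    have h1 : (w₀ a + 1) * n ≤ w₀ b * n := Nat.mul_le_mul_right n hc
    have := a.2
    simp only [w] at hlt
    rw [add_mul] at h1
    omega

/-! ### Row words of tableaux -/

section RowWord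

variable {n : ℕ} {α β : Composition n}

/-- The row word of a filling: its `m`-th letter is the row of the entry `m`. -/
def rowWord (T : Filling α) : Fin n → ℕ := fun m => row (T.symm m)

/-- The entries of every row increase from left to right. -/
def IsRowStd (T : Filling α) : Prop :=
  ∀ c d : Cell α, row c = row d → col c < col d → T c < T d

theorem cell_ext {c d : Cell α} (hr : row c = row d) (hc : col c = col d) : c = d := by
  obtain ⟨i, a⟩ := c
  obtain ⟨j, b⟩ := d
  obtain rfl : i = j := Fin.ext hr
  obtain rfl : a = b := Fin.ext hc
  rfl

/-- The first box of a row. -/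
def firstCell (α : Composition n) (r : ℕ) (hr : r < α.length) : Cell α :=
  ⟨⟨r, hr⟩, ⟨0, α.one_le_blocksFun _⟩⟩

theorem IsRowStd.firstCell_le {T : Filling α} (hT : IsRowStd T) (c : Cell α) :
    T (firstCell α (row c) c.1.2) ≤ T c := by
  by_cases h : col c = 0
  · exact le_of_eq (congrArg T (cell_ext rfl h.symm))
  · exact (hT (firstCell α (row c) c.1.2) c rfl (Nat.pos_of_ne_zero h)).le

theorem rowWord_swapEntries (i : Fin (n - 1)) (T : Filling α) :
    rowWord (swapEntries i T) = rowWord T ∘ sw i := by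
  funext m
  simp [rowWord, swapEntries_symm]

theorem swapEntries_swapEntries (i : Fin (n - 1)) (T : Filling α) :
    swapEntries i (swapEntries i T) = T := by
  ext c
  simp [swapEntries]

theorem IsRowStd.swapEntries {T : Filling α} (hT : IsRowStd T) {i : Fin (n - 1)}
    (h : rowWord T (lo i) ≠ rowWord T (hi i)) : IsRowStd (swapEntries i T) := by
  intro c d hr hlt
  refine swap_lt_swap i (hT c d hr hlt) ?_
  rintro ⟨h1, h2⟩
  rw [← h1, ← h2] at h
  simp only [rowWord, Equiv.symm_apply_apply] at h
  exact h hr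

/-- A filling with increasing rows is determined by its row word. -/
theorem IsRowStd.ext {T U : Filling α} (hT : IsRowStd T) (hU : IsRowStd U)
    (h : rowWord T = rowWord U) : T = U := by
  have hr : ∀ W : Filling α, ∀ i : Fin α.length,
      Set.range (fun j : Fin (α.blocksFun i) => W ⟨i, j⟩) = {m | rowWord W m = i} := by
    intro W i
    ext m
    constructor
    · rintro ⟨j, rfl⟩
      simp [rowWord, row]
    · intro hm
      have h1 : (W.symm m).1 = i := Fin.ext hm
      refine ⟨h1 ▸ (W.symm m).2, ?_⟩
      subst h1
      simp
  have hs : ∀ W : Filling α, IsRowStd W → ∀ i : Fin α.length,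
      StrictMono (fun j : Fin (α.blocksFun i) => W ⟨i, j⟩) := fun W hW i a b hab =>
    hW _ _ rfl hab
  refine Equiv.ext fun ⟨i, j⟩ => ?_
  have := (StrictMono.range_inj (hs T hT i) (hs U hU i)).1 (by rw [hr, hr, h])
  exact congrFun this j

/-- The source tableau: its rows are filled one after the other. -/
def source (α : Composition n) : SIT α where
  entry := α.blocksFinEquiv
  row_lt := by
    rintro ⟨i, a⟩ ⟨j, b⟩ hr hlt
    obtain rfl : i = j := Fin.ext hr
    exact (α.embedding i).strictMono hlt
  col_lt := by
    rintro ⟨i, a⟩ ⟨j, b⟩ ha hb hlt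
    change α.embedding i a < α.embedding j b
    rw [Fin.lt_def, Composition.coe_embedding, Composition.coe_embedding]
    have h1 : α.sizeUpTo i < α.sizeUpTo (i + 1) := α.sizeUpTo_strict_mono i.2
    have h2 : α.sizeUpTo (i + 1) ≤ α.sizeUpTo j := α.monotone_sizeUpTo hlt
    simp only [col] at ha hb
    omega

/-- The row word of the source tableau, which is the sorted word of content `α`. -/
def sourceWord (α : Composition n) : Fin n → ℕ := rowWord (source α).entry

theorem sourceWord_apply (m : Fin n) : sourceWord α m = α.index m := rfl

theorem sourceWord_le_iff (m : Fin n) (r : ℕ) :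
    sourceWord α m ≤ r ↔ (m : ℕ) < α.sizeUpTo (r + 1) := by
  rw [sourceWord_apply]
  constructor
  · intro h
    exact (α.lt_sizeUpTo_index_succ m).trans_le (α.monotone_sizeUpTo (Nat.succ_le_succ h))
  · intro h
    by_contra hc
    push Not at hc
    have h1 : α.sizeUpTo (r + 1) ≤ α.sizeUpTo (α.index m) := α.monotone_sizeUpTo hc
    have h2 := α.sizeUpTo_index_le m
    omega

theorem monotone_sourceWord (α : Composition n) : Monotone (sourceWord α) := fun a b hab => by
  rw [sourceWord_le_iff]
  exact (Fin.le_def.1 hab).trans_lt ((sourceWord_le_iff b _).1 le_rfl)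

theorem isRearr_rowWord (T : Filling α) : IsRearr (sourceWord α) (rowWord T) :=
  ⟨T.symm.trans (source α).entry, by funext m; simp [sourceWord, rowWord]⟩

theorem IsRearr.exists_rowStd {w : Fin n → ℕ} (hw : IsRearr (sourceWord α) w) :
    ∃ T : Filling α, IsRowStd T ∧ rowWord T = w := by
  refine IsRearr.induction (monotone_sourceWord α)
    (Q := fun w => ∃ T : Filling α, IsRowStd T ∧ rowWord T = w)
    ⟨(source α).entry, (source α).row_lt, rfl⟩ ?_ hw
  rintro _ - i hlt ⟨T, hT, rfl⟩
  exact ⟨swapEntries i T, hT.swapEntries hlt.ne, rowWord_swapEntries i T⟩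

/-- Words in which every letter `r + 1` has a letter `r` before it. Among the row words of fillings
with increasing rows, these are the ones of the standard immaculate tableaux. -/
def IsStdWord (w : Fin n → ℕ) : Prop := ∀ m r, w m = r + 1 → ∃ l < m, w l = r

theorem SIT.isStdWord (T : SIT α) : IsStdWord (rowWord T.entry) := by
  intro m r hr
  obtain ⟨c, rfl⟩ := T.entry.surjective m
  simp only [rowWord, Equiv.symm_apply_apply] at hr
  have hlen : r + 1 < α.length := hr ▸ c.1.2
  refine ⟨T.entry (firstCell α r (by omega)), ?_, by simp [rowWord, row, firstCell]⟩
  refine (T.col_lt _ (firstCell α (row c) c.1.2) rfl rfl ?_).trans_le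
    (IsRowStd.firstCell_le T.row_lt c)
  change r < row c
  omega

theorem IsRowStd.exists_SIT {T : Filling α} (hT : IsRowStd T) (hw : IsStdWord (rowWord T)) :
    ∃ U : SIT α, U.entry = T := by
  refine ⟨⟨T, hT, ?_⟩, rfl⟩
  have key : ∀ e : ℕ, ∀ c d : Cell α, col c = 0 → col d = 0 → row d = row c + e + 1 →
      T c < T d := by
    intro e
    induction e with
    | zero =>
      intro c d hc hd hr
      obtain ⟨l, hl, hl'⟩ := hw (T d) (row c) (by simpa [rowWord] using hr)
      refine lt_of_le_of_lt ?_ hl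
      have h1 := hT.firstCell_le (T.symm l)
      rw [Equiv.apply_symm_apply] at h1
      rwa [cell_ext (c := c) (d := firstCell α _ (T.symm l).1.2) hl'.symm hc]
    | succ e ih =>
      intro c d hc hd hr
      have hlen : row d < α.length := d.1.2
      refine (ih c (firstCell α (row c + e + 1) (by omega)) hc rfl rfl).trans ?_
      obtain ⟨l, hl, hl'⟩ := hw (T d) (row c + e + 1) (by simp [rowWord, hr]; omega)
      refine lt_of_le_of_lt ?_ hl
      have h1 := hT.firstCell_le (T.symm l)
      rw [Equiv.apply_symm_apply] at h1
      rwa [cell_ext (c := firstCell α (row c + e + 1) (by omega))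
        (d := firstCell α _ (T.symm l).1.2) hl'.symm rfl]
  intro c d hc hd hlt
  exact key (row d - row c - 1) c d hc hd (by omega)

theorem IsRearr.exists_SIT {w : Fin n → ℕ} (hw : IsRearr (sourceWord α) w) (hs : IsStdWord w) :
    ∃ T : SIT α, rowWord T.entry = w := by
  obtain ⟨T, hT, rfl⟩ := hw.exists_rowStd
  obtain ⟨U, rfl⟩ := hT.exists_SIT hs
  exact ⟨U, rfl⟩

theorem SIT.ext_rowWord {T U : SIT α} (h : rowWord T.entry = rowWord U.entry) : T = U :=
  SIT.entry_injective (IsRowStd.ext T.row_lt U.row_lt h)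

/-! ### Dominance and the lexicographic order -/

theorem card_letters_le {w : Fin n → ℕ} (hw : IsRearr (sourceWord α) w) (r : ℕ) :
    (Finset.univ.filter fun m => w m ≤ r).card = α.sizeUpTo (r + 1) := by
  obtain ⟨σ, rfl⟩ := hw
  have h1 : (Finset.univ.filter fun m => (sourceWord α ∘ σ) m ≤ r).map σ.toEmbedding =
      Finset.univ.filter fun m : Fin n => (m : ℕ) < α.sizeUpTo (r + 1) := by
    ext m
    simp only [Finset.mem_map_equiv, Finset.mem_filter, Finset.mem_univ, true_and,
      Function.comp, Equiv.apply_symm_apply, sourceWord_le_iff]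
  rw [← Finset.card_map σ.toEmbedding, h1, Fin.card_filter_val_lt]
  exact min_eq_right (α.sizeUpTo_le _)

theorem not_lex_of_sum_take_le {a b : List ℕ} (ha : ∀ x ∈ a, 0 < x)
    (h : ∀ r, (a.take (r + 1)).sum ≤ (b.take (r + 1)).sum) : ¬List.Lex (· < ·) b a := by
  intro hl
  induction hl with
  | @nil x l =>
    have h1 := h 0
    have h2 := ha x (by simp)
    simp at h1
    omega
  | @cons x l l' _ ih =>
    refine ih (fun y hy => ha y (by simp [hy])) fun r => ?_
    simpa using h (r + 1)
  | @rel x l y l' hlt =>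
    have h1 := h 0
    simp at h1
    omega

/-- The lexicographic order refines the dominance order. -/
theorem LexLE.eq_of_sizeUpTo_le (h : LexLE β α)
    (hd : ∀ r, α.sizeUpTo (r + 1) ≤ β.sizeUpTo (r + 1)) : β = α :=
  h.resolve_right (not_lex_of_sum_take_le (fun _ hx => α.one_le_blocks hx) hd)

/-- If a standard word `u` can ascend only at the ends of the blocks cut out by `A`, then it takes
at most one new letter per block. -/
theorem IsStdWord.le_of_lt {u : Fin n → ℕ} (hu : IsStdWord u) {A : ℕ → ℕ} (hA : Monotone A)
    (h : ∀ i : Fin (n - 1), u (lo i) < u (hi i) → ∃ q, (i : ℕ) + 1 = A q) (m : Fin n) (r : ℕ)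
    (hm : (m : ℕ) < A r) : u m ≤ r := by
  obtain ⟨m, hmn⟩ := m
  induction m using Nat.strong_induction_on generalizing r with
  | _ m ih =>
    rcases hum : u ⟨m, hmn⟩ with _ | t
    · exact Nat.zero_le r
    · obtain ⟨⟨l, hln⟩, hl, hul⟩ := hu _ _ hum
      change l < m at hl
      simp only at hm
      have hilo : lo (⟨m - 1, by omega⟩ : Fin (n - 1)) = (⟨m - 1, by omega⟩ : Fin n) := rfl
      have hihi : hi (⟨m - 1, by omega⟩ : Fin (n - 1)) = (⟨m, hmn⟩ : Fin n) := by
        simp only [hi, Fin.mk.injEq]; omega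
      by_cases hasc : u ⟨m - 1, by omega⟩ < u ⟨m, hmn⟩
      · obtain ⟨q, hq⟩ := h ⟨m - 1, by omega⟩ (by rwa [hilo, hihi])
        simp only at hq
        have hqr : q < r := by
          by_contra hc
          have := hA (not_lt.1 hc)
          omega
        have h2 : A q ≤ A (r - 1) := hA (by omega)
        have h3 := ih l hl (r - 1) hln (by simp only; omega)
        omega
      · have := ih (m - 1) (by omega) r (by omega) (by simp only; omega)
        omega

/-- A standard immaculate tableau of shape `β` that ascends only at the ends of the blocks cut out
by `A` has at least `A r` boxes in the rows up to `r`. -/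
theorem SIT.le_sizeUpTo (T : SIT β) {A : ℕ → ℕ} (hA : Monotone A) (hn : ∀ r, A r ≤ n)
    (h : ∀ i : Fin (n - 1), rowWord T.entry (lo i) < rowWord T.entry (hi i) →
      ∃ q, (i : ℕ) + 1 = A q) (r : ℕ) : A r ≤ β.sizeUpTo (r + 1) := by
  rw [← card_letters_le (isRearr_rowWord T.entry) r, ← min_eq_right (hn r),
    ← Fin.card_filter_val_lt]
  refine Finset.card_le_card fun m hm => ?_
  simp only [Finset.mem_filter, Finset.mem_univ, true_and] at hm ⊢
  exact T.isStdWord.le_of_lt hA h m r (by simpa using hm)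

theorem exists_eq_sizeUpTo_of_sourceWord_lt {i : Fin (n - 1)}
    (h : sourceWord α (lo i) < sourceWord α (hi i)) :
    ∃ q, (i : ℕ) + 1 = α.sizeUpTo (q + 1) := by
  refine ⟨sourceWord α (lo i), ?_⟩
  have h1 := (sourceWord_le_iff (α := α) (lo i) _).1 le_rfl
  have h2 := mt (sourceWord_le_iff (hi i) (sourceWord α (lo i))).2 h.not_ge
  simp only [lo, hi] at h1 h2 ⊢
  omega

theorem monotone_sizeUpTo_succ (α : Composition n) : Monotone fun r => α.sizeUpTo (r + 1) :=
  fun _ _ h => α.monotone_sizeUpTo (Nat.succ_le_succ h)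

/-- For `β ≤_l α`, a standard immaculate tableau of shape `β` all of whose descents are descents of
the source tableau of shape `α` exists only for `β = α`. -/
theorem SIT.shape_eq (hle : LexLE β α) (T : SIT β)
    (h : ∀ i : Fin (n - 1), sourceWord α (lo i) = sourceWord α (hi i) →
      ¬IsDescent i T.entry) : β = α := by
  refine hle.eq_of_sizeUpTo_le (T.le_sizeUpTo (monotone_sizeUpTo_succ α)
    (fun r => α.sizeUpTo_le _) fun i hi' => exists_eq_sizeUpTo_of_sourceWord_lt ?_)
  exact lt_of_le_of_ne (monotone_sourceWord α (lo_lt_hi i).le) fun he => h i he hi'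

theorem SIT.eq_source (T : SIT α)
    (h : ∀ i : Fin (n - 1), sourceWord α (lo i) = sourceWord α (hi i) →
      ¬IsDescent i T.entry) : T = source α := by
  have hle : ∀ m, rowWord T.entry m ≤ sourceWord α m := fun m =>
    T.isStdWord.le_of_lt (monotone_sizeUpTo_succ α)
      (fun i hi' => exists_eq_sizeUpTo_of_sourceWord_lt
        (lt_of_le_of_ne (monotone_sourceWord α (lo_lt_hi i).le) fun he => h i he hi'))
      m _ ((sourceWord_le_iff m _).1 le_rfl)
  have hsum : ∑ m, rowWord T.entry m = ∑ m, sourceWord α m := by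
    obtain ⟨σ, hσ⟩ := isRearr_rowWord T.entry
    rw [hσ]
    exact Equiv.sum_comp σ _
  refine SIT.ext_rowWord (funext fun m => ?_)
  exact (Finset.sum_eq_sum_iff_of_le fun m _ => hle m).1 hsum m (Finset.mem_univ m)

/-- Moving the end of block `j` of `α` one step to the right makes the composition
lexicographically larger, so for `β ≤_l α` no standard immaculate tableau of shape `β` has all its
descents at the ends of the new blocks. -/
theorem SIT.false_of_ascents (hle : LexLE β α) (T : SIT β) {j : ℕ} (hj : j + 1 < α.length)
    (h : ∀ i : Fin (n - 1), rowWord T.entry (lo i) < rowWord T.entry (hi i) →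
      (∃ r, r ≠ j ∧ (i : ℕ) + 1 = α.sizeUpTo (r + 1)) ∨ (i : ℕ) = α.sizeUpTo (j + 1)) : False := by
  let A : ℕ → ℕ := fun r => α.sizeUpTo (r + 1) + if r = j then 1 else 0
  have hs : α.sizeUpTo (j + 1) < α.sizeUpTo (j + 1 + 1) := α.sizeUpTo_strict_mono hj
  have hA : Monotone A := by
    refine monotone_nat_of_le_succ fun r => ?_
    have h1 : α.sizeUpTo (r + 1) ≤ α.sizeUpTo (r + 1 + 1) := α.monotone_sizeUpTo (by omega)
    simp only [A]
    by_cases hr : r = j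
    · subst hr
      rw [if_pos rfl, if_neg (by omega)]
      omega
    · rw [if_neg hr]
      omega
  have hn : ∀ r, A r ≤ n := by
    intro r
    have h1 := α.sizeUpTo_le (r + 1)
    have h2 := α.sizeUpTo_le (j + 1 + 1)
    simp only [A]
    split_ifs with hr
    · subst hr; omega
    · omega
  have key := T.le_sizeUpTo hA hn fun i hi' => by
    rcases h i hi' with ⟨r, hr, he⟩ | he
    · exact ⟨r, by simp [A, hr, he]⟩
    · exact ⟨j, by simp [A, he]⟩
  obtain rfl := hle.eq_of_sizeUpTo_le fun r => (Nat.le_add_right _ _).trans (key r)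
  have := key j
  simp [A] at this

end RowWord

/-! ### Fixed vectors in the modules `V α` -/

section Modules

variable {n : ℕ} {α β : Composition n}

/-- The coefficient of a tableau in a vector. -/
noncomputable def coeff (T : SIT α) : V α →ₗ[ℂ] ℂ := (Finsupp.lapply T : (SIT α →₀ ℂ) →ₗ[ℂ] ℂ)

open Classical in
theorem coeff_basisVec (T U : SIT α) : coeff T (V.basisVec U) = if U = T then 1 else 0 :=
  Finsupp.single_apply

theorem V.ext_coeff {v w : V α} (h : ∀ T, coeff T v = coeff T w) : v = w := Finsupp.ext h

theorem V.basisVec_ne_zero (T : SIT α) : V.basisVec T ≠ 0 := fun h => by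
  simpa [coeff_basisVec] using congrArg (coeff T) h

theorem V.mem_of_basisVec_mem (S : Submodule ℂ (V α)) (h : ∀ T, V.basisVec T ∈ S) (v : V α) :
    v ∈ S := by
  refine Finsupp.induction_linear (motive := fun v : SIT α →₀ ℂ => (show V α from v) ∈ S) v
    S.zero_mem (fun _ _ h1 h2 => S.add_mem h1 h2) fun T c => ?_
  have : (Finsupp.single T c : SIT α →₀ ℂ) = c • Finsupp.single T 1 := by simp
  rw [this]
  exact S.smul_mem c (h T)

theorem gen_smul_eq_act (i : Fin (n - 1)) (v : V α) : gen i • v = act α i v := by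
  change rep α (gen i) v = _
  simp [rep, gen]

theorem not_isDescent_swap (i : Fin (n - 1)) (T : SIT α) (hd : IsDescent i T.entry)
    (hc : ¬BothFirstColumn i T.entry) : ¬IsDescent i (T.swap i hd hc).entry := by
  simp only [SIT.swap, IsDescent, swapEntries_symm, Equiv.swap_apply_left, Equiv.swap_apply_right,
    not_lt]
  exact hd.le

/-- The image of `π_i` is spanned by the tableaux of which `i` is not a descent. -/
theorem coeff_gen_smul_of_isDescent {i : Fin (n - 1)} {T : SIT α} (hT : IsDescent i T.entry)
    (v : V α) : coeff T (gen i • v) = 0 := by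
  rw [gen_smul_eq_act]
  refine V.mem_of_basisVec_mem (LinearMap.ker (coeff T ∘ₗ act α i)) (fun U => ?_) v
  rw [LinearMap.mem_ker, LinearMap.comp_apply, act_basisVec, actBasis]
  split_ifs with hd hc
  · exact map_zero _
  · rw [coeff_basisVec, if_neg]
    rintro rfl
    exact not_isDescent_swap i U hd hc hT
  · rw [coeff_basisVec, if_neg]
    rintro rfl
    exact hd hT

theorem coeff_eq_zero_of_fixed {i : Fin (n - 1)} {T : SIT α} (hT : IsDescent i T.entry)
    {v : V α} (hv : gen i • v = v) : coeff T v = 0 := by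
  rw [← hv]
  exact coeff_gen_smul_of_isDescent hT v

/-- A vector is fixed by the non-descents of the source tableau of shape `α`. -/
def IsSourceFixed (α : Composition n) {X : Type} [AddCommGroup X] [Module (H n) X] (x : X) :
    Prop :=
  ∀ i : Fin (n - 1), sourceWord α (lo i) = sourceWord α (hi i) → gen i • x = x

theorem isSourceFixed_source (α : Composition n) : IsSourceFixed α (V.basisVec (source α)) := by
  intro i hi'
  rw [gen_smul_basisVec, actBasis, dif_neg]
  exact fun hd => absurd hi' (ne_of_lt hd)

theorem IsSourceFixed.eq_zero {v : V β} (hv : IsSourceFixed α v) (hle : LexLE β α) (hne : β ≠ α) :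
    v = 0 := by
  refine V.ext_coeff fun T => ?_
  rw [map_zero]
  by_contra hc
  exact hne (T.shape_eq hle fun i hi' hd => hc (coeff_eq_zero_of_fixed hd (hv i hi')))

theorem IsSourceFixed.eq_smul {v : V α} (hv : IsSourceFixed α v) :
    v = coeff (source α) v • V.basisVec (source α) := by
  refine V.ext_coeff fun T => ?_
  rw [map_smul, coeff_basisVec]
  split_ifs with h
  · rw [h, smul_eq_mul, mul_one]
  · rw [smul_zero]
    by_contra hc
    exact h (T.eq_source fun i hi' hd => hc (coeff_eq_zero_of_fixed hd (hv i hi'))).symm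

/-- A vector that is fixed by all `π_i`, except where a block of `α` may end after its last box
has been moved one step to the right, vanishes in `V β` for `β ≤_l α`. -/
theorem eq_zero_of_fixed (hle : LexLE β α) {v : V β} {j : ℕ} (hj : j + 1 < α.length)
    (hv : ∀ i : Fin (n - 1), gen i • v = v ∨
      (∃ r, r ≠ j ∧ (i : ℕ) + 1 = α.sizeUpTo (r + 1)) ∨ (i : ℕ) = α.sizeUpTo (j + 1)) :
    v = 0 := by
  refine V.ext_coeff fun T => ?_
  rw [map_zero]
  by_contra hc
  exact T.false_of_ascents hle hj fun i hd =>
    (hv i).resolve_left fun hf => hc (coeff_eq_zero_of_fixed hd hf)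

/-! ### Vanishing on words that are not standard -/

/-- If a letter `j + 1` of a word has no letter `j` to its left, then swapping two adjacent letters
keeps the word nonstandard, unless it is this `j + 1` that is swapped with a letter `j`. -/
theorem not_isStdWord_comp_sw {w : Fin n → ℕ} {m : Fin n} {j : ℕ} (hm : w m = j + 1)
    (hj : ∀ l < m, w l ≠ j) (i : Fin (n - 1))
    (hne : ¬(lo i = m ∧ w (hi i) = j)) : ¬IsStdWord (w ∘ sw i) := by
  intro hs
  obtain ⟨l, hl, hl'⟩ := hs (sw i m) j (by simpa [sw_sw] using hm)
  have h1 : ¬sw i l < m := fun h => hj _ h hl'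
  have h2 : sw i l ≠ m := fun h => by
    rw [Function.comp, h, hm] at hl'
    omega
  have h3 : m < sw i l := lt_of_le_of_ne (not_lt.1 h1) h2.symm
  have h4 : m = lo i ∧ sw i l = hi i := by
    by_contra hc
    have := swap_lt_swap i h3 hc
    change sw i m < sw i (sw i l) at this
    rw [sw_sw] at this
    exact absurd hl this.not_gt
  refine hne ⟨h4.1.symm, ?_⟩
  rw [← h4.2]
  exact hl'

/-- The ascents of a word of content `α` with the single descent from a letter `j + 1` in position
`m` to a letter `j`, both of which are the first of their kind: compared with the sorted word, the
first `j + 1` has been moved to the left of all letters `j`, so the block of the letters `j` ends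
one step later. -/
theorem ascents_of_minimal {w : Fin n → ℕ} (hw : IsRearr (sourceWord α) w) {m : Fin n} {j : ℕ}
    (hm : w m = j + 1) (hj : ∀ l < m, w l ≠ j ∧ w l ≠ j + 1) (hex : ∃ l, w l = j)
    (hd : ∀ i : Fin (n - 1), w (hi i) < w (lo i) → lo i = m ∧ w (hi i) = j)
    (i : Fin (n - 1)) (ha : w (lo i) < w (hi i)) :
    (∃ r, r ≠ j ∧ (i : ℕ) + 1 = α.sizeUpTo (r + 1)) ∨ (i : ℕ) = α.sizeUpTo (j + 1) := by
  have mono1 : ∀ a b : Fin n, a ≤ b → b ≤ m → w a ≤ w b := fun a b hab hbm =>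
    le_of_no_descent w hab fun i _ h2 => by
      by_contra hc
      obtain ⟨h3, -⟩ := hd i (not_le.1 hc)
      exact absurd (h3 ▸ lo_lt_hi i) (h2.trans hbm).not_gt
  have mono2 : ∀ a b : Fin n, a ≤ b → m < a → w a ≤ w b := fun a b hab hma =>
    le_of_no_descent w hab fun i h1 _ => by
      by_contra hc
      obtain ⟨h3, -⟩ := hd i (not_le.1 hc)
      exact absurd (h3 ▸ h1) hma.not_ge
  have left : ∀ a : Fin n, a < m → w a < j := fun a h => by
    have := mono1 a m h.le le_rfl
    have := hj a h
    omega
  have right : ∀ a : Fin n, m < a → j ≤ w a := by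
    -- a letter `j` occurs to the right of `m`, so the word descends there
    obtain ⟨l, hl⟩ := hex
    have hml : m < l := by
      by_contra hc
      rcases (not_lt.1 hc).lt_or_eq with h | h
      · exact (hj l h).1 hl
      · rw [h] at hl; omega
    intro a hma
    by_contra hc
    have hnd : ¬∀ i : Fin (n - 1), m ≤ lo i → hi i ≤ a → w (lo i) ≤ w (hi i) := fun hall => by
      have := le_of_no_descent w hma.le hall
      omega
    push Not at hnd
    obtain ⟨i, -, -, hdi⟩ := hnd
    obtain ⟨h1, h2⟩ := hd i hdi
    have h3 : hi i ≤ a := by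
      rw [Fin.lt_def, ← h1] at hma
      rw [Fin.le_def]
      exact hma
    have := mono2 (hi i) a h3 (h1 ▸ lo_lt_hi i)
    omega
  have him : lo i ≠ m := by
    -- at `m` itself the word descends
    obtain ⟨l, hl⟩ := hex
    rintro rfl
    have hml : lo i < l := by
      by_contra hc
      rcases (not_lt.1 hc).lt_or_eq with h | h
      · exact (hj l h).1 hl
      · rw [h] at hl; omega
    have := mono2 (hi i) l hml (lo_lt_hi i)
    omega
  have hcard := card_letters_le hw (w (lo i))
  have lh : ∀ a : Fin n, ¬a ≤ lo i → hi i ≤ a := fun a h => by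
    simp only [Fin.le_def, lo, hi] at h ⊢
    omega
  have hci : (Finset.univ.filter fun a : Fin n => a ≤ lo i).card = i + 1 := by
    have : (Finset.univ.filter fun a : Fin n => a ≤ lo i) =
        Finset.univ.filter fun a : Fin n => (a : ℕ) < i + 1 := by
      ext a
      simp only [Finset.mem_filter, Finset.mem_univ, true_and, Fin.le_def, lo]
      omega
    rw [this, Fin.card_filter_val_lt]
    omega
  rcases him.lt_or_gt with hlt | hlt
  · left
    refine ⟨w (lo i), (left _ hlt).ne, ?_⟩
    rw [← hcard, ← hci]
    congr 1
    ext a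
    simp only [Finset.mem_filter, Finset.mem_univ, true_and]
    refine ⟨fun h => mono1 _ _ h hlt.le, fun h => ?_⟩
    by_contra hc
    rcases le_or_gt a m with h1 | h1
    · have := mono1 _ _ (lh a hc) h1
      omega
    · have := right a h1
      have := left _ hlt
      omega
  · by_cases hr : w (lo i) = j
    · right
      have he : (Finset.univ.filter fun a => w a ≤ w (lo i)) =
          (Finset.univ.filter fun a : Fin n => a ≤ lo i).erase m := by
        ext a
        simp only [Finset.mem_filter, Finset.mem_univ, true_and, Finset.mem_erase]
        constructor
        · intro h
          refine ⟨?_, ?_⟩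
          · rintro rfl; omega
          · by_contra hc
            have := mono2 _ _ (lh a hc) (hlt.trans (lo_lt_hi i))
            omega
        · rintro ⟨h1, h2⟩
          rcases h1.lt_or_gt with h3 | h3
          · have := left a h3
            omega
          · exact mono2 _ _ h2 h3
      rw [he, Finset.card_erase_of_mem (by simpa using hlt.le), hci, hr] at hcard
      omega
    · left
      refine ⟨w (lo i), hr, ?_⟩
      rw [← hcard, ← hci]
      have hge := right _ hlt
      congr 1
      ext a
      simp only [Finset.mem_filter, Finset.mem_univ, true_and]
      constructor
      · intro h
        rcases lt_trichotomy a m with h1 | rfl | h1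
        · have := left a h1
          omega
        · omega
        · exact mono2 _ _ h h1
      · intro h
        by_contra hc
        have := mono2 _ _ (lh a hc) (hlt.trans (lo_lt_hi i))
        omega

/-- Vectors `y w` of `V β`, indexed by words of content `α` and moved by the generators like
fillings with increasing rows, vanish at the words that are not standard, if `β ≤_l α`. By
induction it is enough to treat the nonstandard words that become standard as soon as a descent is
sorted; at these, `y w` is fixed by too many generators. -/
theorem eq_zero_of_not_isStdWord (hle : LexLE β α) (y : (Fin n → ℕ) → V β)
    (hlt : ∀ w, IsRearr (sourceWord α) w → ¬IsStdWord w → ∀ i : Fin (n - 1),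
      w (lo i) < w (hi i) → gen i • y w = y (w ∘ sw i))
    (hge : ∀ w, IsRearr (sourceWord α) w → ¬IsStdWord w → ∀ i : Fin (n - 1),
      w (hi i) ≤ w (lo i) → gen i • y w = y w)
    {w : Fin n → ℕ} (hw : IsRearr (sourceWord α) w) (hs : ¬IsStdWord w) : y w = 0 := by
  induction hN : inv w using Nat.strong_induction_on generalizing w with
  | _ N ih =>
    subst hN
    by_cases hred : ∃ i : Fin (n - 1), w (hi i) < w (lo i) ∧ ¬IsStdWord (w ∘ sw i)
    · obtain ⟨i, hd, hs'⟩ := hred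
      have h1 := hlt _ (hw.comp_sw i) hs' i (by simpa using hd)
      rw [comp_sw_comp_sw, ih _ (inv_comp_sw_lt w i hd) (hw.comp_sw i) hs' rfl, smul_zero] at h1
      exact h1.symm
    · push Not at hred
      have hs0 := hs
      unfold IsStdWord at hs0
      push Not at hs0
      obtain ⟨m', j, hm', hj'⟩ := hs0
      obtain ⟨m, ⟨hm, hml⟩, hmin⟩ := WellFounded.has_min (wellFounded_lt (α := Fin n))
        {m | w m = j + 1 ∧ ∀ l < m, w l ≠ j} ⟨m', hm', hj'⟩
      have hfirst : ∀ l < m, w l ≠ j ∧ w l ≠ j + 1 := fun l hl =>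
        ⟨hml l hl, fun h => hmin l ⟨h, fun l' hl' => hml l' (hl'.trans hl)⟩ hl⟩
      have hjlen : j + 1 < α.length := by
        obtain ⟨σ, rfl⟩ := hw
        rw [← hm]
        exact (α.index (σ m)).2
      have hex : ∃ l, w l = j := by
        obtain ⟨σ, rfl⟩ := hw
        refine ⟨σ.symm ((source α).entry (firstCell α j (by omega))), ?_⟩
        simp [sourceWord, rowWord, row, firstCell]
      refine eq_zero_of_fixed hle hjlen fun i => ?_
      rcases le_or_gt (w (hi i)) (w (lo i)) with h | h
      · exact Or.inl (hge w hw hs i h)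
      · refine Or.inr (ascents_of_minimal hw hm hfirst hex (fun i' hd => ?_) i h)
        by_contra hc
        exact not_isStdWord_comp_sw hm hml i' hc (hred i' hd)

/-! ### The basis of tableaux along words -/

/-- Swapping the entries `i` and `i + 1` of a standard immaculate tableau in which `i` is strictly
below `i + 1`. -/
def SIT.unswap (i : Fin (n - 1)) (T : SIT α)
    (h : rowWord T.entry (hi i) < rowWord T.entry (lo i)) : SIT α where
  entry := swapEntries i T.entry
  row_lt := IsRowStd.swapEntries T.row_lt h.ne'
  col_lt c d h0 h0' hlt := by
    refine swap_lt_swap i (T.col_lt c d h0 h0' hlt) ?_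
    rintro ⟨h1, h2⟩
    rw [← h1, ← h2] at h
    simp only [rowWord, Equiv.symm_apply_apply] at h
    exact h.not_gt hlt

theorem gen_smul_unswap (i : Fin (n - 1)) (T : SIT α)
    (h : rowWord T.entry (hi i) < rowWord T.entry (lo i)) :
    gen i • V.basisVec (T.unswap i h) = V.basisVec T := by
  have hd : IsDescent i (T.unswap i h).entry := by
    simpa [IsDescent, SIT.unswap, swapEntries_symm, rowWord] using h
  have hc : ¬BothFirstColumn i (T.unswap i h).entry := by
    rintro ⟨h1, h2⟩
    simp only [SIT.unswap, swapEntries_symm, Equiv.swap_apply_left,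
      Equiv.swap_apply_right] at h1 h2
    have := T.col_lt _ _ h1 h2 h
    simp only [Equiv.apply_symm_apply] at this
    exact this.not_gt (lo_lt_hi i)
  rw [gen_smul_basisVec, actBasis, dif_pos hd, dif_neg hc]
  congr 1
  exact SIT.entry_injective (swapEntries_swapEntries i T.entry)

theorem wordAct_source (T : SIT α) :
    wordAct (V.basisVec (source α)) (rowWord T.entry) = V.basisVec T := by
  induction hN : inv (rowWord T.entry) using Nat.strong_induction_on generalizing T with
  | _ N ih =>
    subst hN
    by_cases hd : ∃ i : Fin (n - 1), rowWord T.entry (hi i) < rowWord T.entry (lo i)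
    · obtain ⟨i, h⟩ := hd
      have hw : rowWord (T.unswap i h).entry = rowWord T.entry ∘ sw i :=
        rowWord_swapEntries i T.entry
      rw [wordAct_of_descent _ _ i h, ← hw, ih _ (hw ▸ inv_comp_sw_lt _ i h) _ rfl,
        gen_smul_unswap]
    · push Not at hd
      rw [wordAct_of_sorted _ hd]
      congr 1
      exact SIT.ext_rowWord
        ((isRearr_rowWord T.entry).eq_of_monotone (monotone_sourceWord α) hd).symm

theorem wordAct_source_of_not_isStdWord {w : Fin n → ℕ} (hw : IsRearr (sourceWord α) w)
    (hs : ¬IsStdWord w) : wordAct (V.basisVec (source α)) w = 0 := by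
  refine eq_zero_of_not_isStdWord (Or.inl rfl) (wordAct (V.basisVec (source α)))
    (fun w _ _ i h => gen_smul_wordAct_of_lt _ h) (fun w hw _ i h => ?_) hw hs
  rcases h.lt_or_eq with h | h
  · exact gen_smul_wordAct_of_gt _ h
  · exact gen_smul_wordAct_of_eq _ (monotone_sourceWord α) (isSourceFixed_source α) hw h.symm

theorem map_wordAct {X Y : Type*} [AddCommGroup X] [Module (H n) X] [AddCommGroup Y]
    [Module (H n) Y] (f : X →ₗ[H n] Y) (x : X) (w : Fin n → ℕ) :
    f (wordAct x w) = wordAct (f x) w := by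
  induction hN : inv w using Nat.strong_induction_on generalizing w with
  | _ N ih =>
    subst hN
    by_cases hd : ∃ i : Fin (n - 1), w (hi i) < w (lo i)
    · obtain ⟨i, h⟩ := hd
      rw [wordAct_of_descent x w i h, wordAct_of_descent (f x) w i h, map_smul,
        ih _ (inv_comp_sw_lt w i h) _ rfl]
    · push Not at hd
      rw [wordAct_of_sorted x hd, wordAct_of_sorted (f x) hd]

theorem wordAct_mem_span_singleton {X : Type*} [AddCommGroup X] [Module (H n) X] (x : X)
    (w : Fin n → ℕ) : wordAct x w ∈ Submodule.span (H n) {x} := by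
  have := map_wordAct (LinearMap.toSpanSingleton (H n) X x) 1 w
  rw [LinearMap.toSpanSingleton_apply, LinearMap.toSpanSingleton_apply, one_smul] at this
  rw [← this]
  exact Submodule.smul_mem _ _ (Submodule.mem_span_singleton_self x)

theorem span_source (α : Composition n) :
    Submodule.span (H n) {V.basisVec (source α)} = ⊤ := by
  refine eq_top_iff.2 fun v _ => ?_
  refine V.mem_of_basisVec_mem
    ((Submodule.span (H n) {V.basisVec (source α)}).restrictScalars ℂ) (fun T => ?_) v
  rw [← wordAct_source T]
  exact wordAct_mem_span_singleton _ _

end Modules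

/-! ### Projective covers over Artinian rings -/

/-- Over an Artinian ring, a minimal projective submodule of the regular module among those that
still map onto a given cyclic module is a projective cover of it: by Fitting's lemma, an
endomorphism over the cyclic module with a smaller image would split off a smaller one. -/
theorem exists_isProjectiveCover {R : Type} [Ring R] [IsArtinianRing R] {M : Type}
    [AddCommGroup M] [Module R M] (f₀ : R →ₗ[R] M) (hf₀ : Function.Surjective f₀) :
    ∃ (P : Type) (_ : AddCommGroup P) (_ : Module R P) (f : P →ₗ[R] M), IsProjectiveCover f := by
  obtain ⟨Q, ⟨hproj, hsurj⟩, hmin⟩ := WellFounded.has_min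
    (wellFounded_lt (α := Submodule R R))
    {Q : Submodule R R | Module.Projective R Q ∧ Function.Surjective (f₀ ∘ₗ Q.subtype)}
    ⟨⊤, Module.Projective.of_equiv' (Submodule.topEquiv (R := R) (M := R)).symm, fun m => by
      obtain ⟨r, hr⟩ := hf₀ m
      exact ⟨⟨r, trivial⟩, hr⟩⟩
  refine ⟨Q, inferInstance, inferInstance, f₀ ∘ₗ Q.subtype, hproj, hsurj, ?_⟩
  intro X _ _ g hg
  set f : Q →ₗ[R] M := f₀ ∘ₗ Q.subtype with hf
  -- an endomorphism of `Q` over `M` with image in that of `g`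
  obtain ⟨h', hh'⟩ := Module.projective_lifting_property (f ∘ₗ g) f hg
  let h : Module.End R Q := g ∘ₗ h'
  have hfh : f ∘ₗ h = f := hh'
  have hpow : ∀ N : ℕ, f ∘ₗ (h ^ N : Module.End R Q) = f := by
    intro N
    induction N with
    | zero => rfl
    | succ N ih =>
      rw [pow_succ]
      change (f ∘ₗ (h ^ N : Module.End R Q)) ∘ₗ h = f
      rw [ih, hfh]
  obtain ⟨N, hN1, hN⟩ :=
    ((Filter.eventually_ge_atTop 1).and h.eventually_isCompl_ker_pow_range_pow).exists
  set L : Submodule R Q := LinearMap.range (h ^ N) with hL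
  have hLproj : Module.Projective R L := by
    refine Module.Projective.of_split L.subtype (L.projectionOnto _ hN.symm) ?_
    ext x
    simp
  let e := Submodule.equivMapOfInjective Q.subtype Q.injective_subtype L
  have hmem : L.map Q.subtype ∈
      {Q : Submodule R R | Module.Projective R Q ∧ Function.Surjective (f₀ ∘ₗ Q.subtype)} := by
    refine ⟨Module.Projective.of_equiv' e, fun m => ?_⟩
    obtain ⟨q, rfl⟩ := hsurj m
    refine ⟨⟨((h ^ N) q : Q), ⟨(h ^ N) q, LinearMap.mem_range_self _ q, rfl⟩⟩, ?_⟩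
    exact LinearMap.congr_fun (hpow N) q
  have htop : L = ⊤ := by
    by_contra hne
    refine hmin _ hmem (lt_of_le_of_ne (Submodule.map_subtype_le _ _) fun heq => hne ?_)
    refine eq_top_iff.2 fun q _ => ?_
    obtain ⟨q', hq', he⟩ : (q : R) ∈ L.map Q.subtype := heq.ge q.2
    rwa [← Subtype.ext (a1 := q') (a2 := q) he]
  intro q
  obtain ⟨q', hq'⟩ : q ∈ L := htop ▸ Submodule.mem_top
  obtain ⟨N, rfl⟩ := Nat.exists_eq_add_of_le' hN1
  rw [pow_succ'] at hq'
  exact ⟨h' ((h ^ N) q'), hq'⟩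

theorem IsEssentialEpi.eq_top_of_map_eq_top {R : Type} [Ring R] {A B : Type} [AddCommGroup A]
    [Module R A] [AddCommGroup B] [Module R B] {f : A →ₗ[R] B} (hf : IsEssentialEpi f)
    {N : Submodule R A} (hN : N.map f = ⊤) : N = ⊤ := by
  have h := hf.2 N N.subtype
    (by rw [← LinearMap.range_eq_top, LinearMap.range_comp, Submodule.range_subtype, hN])
  rw [← Submodule.range_subtype N]
  exact LinearMap.range_eq_top.2 h

/-! ### Syzygies and extensions -/

section Syzygy

variable {n : ℕ} {α β : Composition n}

/-- Let `x` generate a module `P` over `V α` and be moved by the generators like the source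
tableau. Then `P` is spanned by the vectors reached from `x` along words of content `α`. Those along
standard words lift the tableaux, so those along the other words span the kernel, and every
homomorphism to `V β` kills them. -/
theorem hom_ker_eq_zero (hle : LexLE β α) {P : Type} [AddCommGroup P] [Module (H n) P]
    (f : P →ₗ[H n] V α) {x : P} (hfx : f x = V.basisVec (source α)) (hx : IsSourceFixed α x)
    (hgen : Submodule.span (H n) {x} = ⊤) (g : LinearMap.ker f →ₗ[H n] V β) : g = 0 := by
  let _ : Module ℂ P := Module.compHom P (algebraMap ℂ (H n))
  have : IsScalarTower ℂ (H n) P := ⟨fun c h y => by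
    change (c • h) • y = algebraMap ℂ (H n) c • h • y
    rw [Algebra.smul_def, mul_smul]⟩
  have hker : ∀ w, IsRearr (sourceWord α) w → ¬IsStdWord w → wordAct x w ∈ LinearMap.ker f :=
    fun w hw hs => by
      rw [LinearMap.mem_ker, map_wordAct, hfx, wordAct_source_of_not_isStdWord hw hs]
  have hmove : ∀ w (hw : IsRearr (sourceWord α) w) (hs : ¬IsStdWord w), ∀ i : Fin (n - 1),
      w (lo i) < w (hi i) → ¬IsStdWord (w ∘ sw i) := by
    intro w hw hs i hlt hs'
    have h1 := hker w hw hs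
    obtain ⟨T, hT⟩ := (hw.comp_sw i).exists_SIT hs'
    refine V.basisVec_ne_zero T ?_
    rw [← wordAct_source T, hT, ← gen_smul_wordAct_of_lt _ hlt, ← hfx, ← map_wordAct,
      LinearMap.mem_ker.1 h1, smul_zero]
  have hge : ∀ w, IsRearr (sourceWord α) w → ∀ i : Fin (n - 1), w (hi i) ≤ w (lo i) →
      gen i • wordAct x w = wordAct x w := fun w hw i h => by
    rcases h.lt_or_eq with h | h
    · exact gen_smul_wordAct_of_gt _ h
    · exact gen_smul_wordAct_of_eq _ (monotone_sourceWord α) hx hw h.symm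
  have hzero : ∀ w (hw : IsRearr (sourceWord α) w) (hs : ¬IsStdWord w),
      g ⟨wordAct x w, hker w hw hs⟩ = 0 := by
    classical
    intro w hw hs
    let y : (Fin n → ℕ) → V β := fun w =>
      if h : wordAct x w ∈ LinearMap.ker f then g ⟨wordAct x w, h⟩ else 0
    have hy : ∀ w (h : wordAct x w ∈ LinearMap.ker f), y w = g ⟨wordAct x w, h⟩ :=
      fun w h => dif_pos h
    rw [← hy]
    refine eq_zero_of_not_isStdWord hle y (fun w hw hs i h => ?_) (fun w hw hs i h => ?_) hw hs
    · rw [hy w (hker w hw hs), hy _ (hker _ (hw.comp_sw i) (hmove w hw hs i h)), ← map_smul]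
      congr 1
      exact Subtype.ext (gen_smul_wordAct_of_lt x h)
    · rw [hy w (hker w hw hs), ← map_smul]
      congr 1
      exact Subtype.ext (hge w hw i h)
  let S : Submodule ℂ P :=
    Submodule.span ℂ (wordAct x '' {w | IsRearr (sourceWord α) w ∧ ¬IsStdWord w})
  have hS : ∀ z ∈ S, ∃ hz : z ∈ LinearMap.ker f, g ⟨z, hz⟩ = 0 := by
    intro z hz
    have hle : S ≤ ((LinearMap.ker g).map (LinearMap.ker f).subtype).restrictScalars ℂ := by
      refine Submodule.span_le.2 ?_
      rintro _ ⟨w, ⟨hw, hs⟩, rfl⟩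
      exact ⟨⟨wordAct x w, hker w hw hs⟩, hzero w hw hs, rfl⟩
    obtain ⟨⟨z', hz'⟩, h0, rfl⟩ := hle hz
    exact ⟨hz', h0⟩
  let ψ : V α →ₗ[ℂ] P :=
    (Finsupp.linearCombination ℂ (fun T : SIT α => wordAct x (rowWord T.entry)) :
      (SIT α →₀ ℂ) →ₗ[ℂ] P)
  have hψ : ∀ T, ψ (V.basisVec T) = wordAct x (rowWord T.entry) := fun T =>
    (Finsupp.linearCombination_single ℂ 1 T).trans (one_smul ℂ _)
  have hfψ : ∀ v, f (ψ v) = v := by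
    intro v
    have := V.mem_of_basisVec_mem (LinearMap.ker (f.restrictScalars ℂ ∘ₗ ψ - LinearMap.id))
      (fun T => ?_) v
    · simpa [sub_eq_zero] using this
    · simp [hψ, map_wordAct, hfx, wordAct_source]
  have hall : ∀ z : P, z ∈ LinearMap.range ψ ⊔ S := by
    intro z
    obtain ⟨h, rfl⟩ := Submodule.mem_span_singleton.1 (hgen ▸ Submodule.mem_top : z ∈ _)
    refine Submodule.span_le.2 ?_ (smul_mem_span_wordAct x (monotone_sourceWord α) hx h)
    rintro _ ⟨w, hw, rfl⟩
    by_cases hs : IsStdWord w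
    · obtain ⟨T, rfl⟩ := IsRearr.exists_SIT hw hs
      exact Submodule.mem_sup_left ⟨V.basisVec T, hψ T⟩
    · exact Submodule.mem_sup_right (Submodule.subset_span ⟨w, ⟨hw, hs⟩, rfl⟩)
  refine LinearMap.ext fun ⟨z, hz⟩ => ?_
  obtain ⟨_, ⟨t, rfl⟩, s, hs, rfl⟩ := Submodule.mem_sup.1 (hall z)
  obtain ⟨hsk, hs0⟩ := hS s hs
  have ht : t = 0 := by
    have h1 := LinearMap.mem_ker.1 hz
    rwa [map_add, hfψ, LinearMap.mem_ker.1 hsk, add_zero] at h1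
  subst ht
  simpa using hs0

theorem IsProjectiveCover.hom_ker_eq_zero (hle : LexLE β α) {P : Type} [AddCommGroup P]
    [Module (H n) P] {f : P →ₗ[H n] V α} (hf : IsProjectiveCover f)
    (g : LinearMap.ker f →ₗ[H n] V β) : g = 0 := by
  obtain ⟨x₀, hx₀⟩ := hf.2.1 (V.basisVec (source α))
  obtain ⟨p, hp, hfix⟩ := exists_parabolic_absorber (monotone_sourceWord α)
  have hfx : f (p • x₀) = V.basisVec (source α) := by
    rw [map_smul, hx₀]
    exact hfix _ _ (isSourceFixed_source α)
  refine ZeroHecke.hom_ker_eq_zero hle f hfx (fun i h => by rw [← mul_smul, hp i h]) ?_ g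
  refine hf.2.eq_top_of_map_eq_top ?_
  rw [Submodule.map_span, Set.image_singleton, hfx, span_source]

theorem exists_isProjectiveCover_V (α : Composition n) :
    ∃ (P : Type) (_ : AddCommGroup P) (_ : Module (H n) P) (f : P →ₗ[H n] V α),
      IsProjectiveCover f := by
  have : IsArtinianRing (H n) := IsArtinianRing.of_finite ℂ (H n)
  refine exists_isProjectiveCover (LinearMap.toSpanSingleton (H n) (V α)
    (V.basisVec (source α))) ?_
  rw [← LinearMap.range_eq_top, LinearMap.range_toSpanSingleton, span_source]

open CategoryTheory in
/-- If the kernel of a surjection from a projective module has no nonzero homomorphism to `B`, then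
the long exact sequence gives the vanishing of the first extension group. -/
theorem subsingleton_ext_one {R : Type} [Ring R] {P A B : Type} [AddCommGroup P] [Module R P]
    [AddCommGroup A] [Module R A] [AddCommGroup B] [Module R B] [Module.Projective R P]
    (f : P →ₗ[R] A) (hf : Function.Surjective f) (h : ∀ g : LinearMap.ker f →ₗ[R] B, g = 0) :
    Subsingleton (Abelian.Ext (ModuleCat.of R A) (ModuleCat.of R B) 1) := by
  have hS := LinearMap.shortExact_shortComplexKer hf
  have : Projective (ModuleCat.of R P) :=
    (IsProjective.iff_projective P).1 inferInstance
  refine subsingleton_of_forall_eq 0 fun e => ?_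
  obtain ⟨x, hx⟩ := Abelian.Ext.contravariant_sequence_exact₃ hS (ModuleCat.of R B) e
    (Abelian.Ext.eq_zero_of_projective (P := ModuleCat.of R P) _) (add_zero 1)
  obtain ⟨φ, rfl⟩ := (Abelian.Ext.mk₀_bijective _ _).2 x
  have : φ = 0 := ModuleCat.hom_ext (h φ.hom)
  rw [← hx, this, Abelian.Ext.mk₀_zero, Abelian.Ext.comp_zero]

/-! ### Endomorphisms of quotients -/

/-- An endomorphism of a quotient of `V α` sends the generator to a vector that is fixed by the same
generators. Applying the parabolic element to a preimage gives a preimage that is fixed as well, so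
a multiple of the source tableau. -/
theorem exists_end_eq_smul (N : Submodule (H n) (V α)) (φ : Module.End (H n) (V α ⧸ N)) :
    ∃ c : ℂ, φ = algebraMap ℂ _ c := by
  obtain ⟨p, hp, hfix⟩ := exists_parabolic_absorber (monotone_sourceWord α)
  set v := V.basisVec (source α)
  have hφv : IsSourceFixed α (φ (N.mkQ v)) := fun i h => by
    rw [← map_smul, ← map_smul, isSourceFixed_source α i h]
  obtain ⟨y, hy⟩ := N.mkQ_surjective (φ (N.mkQ v))
  have hpy : IsSourceFixed α (p • y) := fun i h => by rw [← mul_smul, hp i h]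
  refine ⟨coeff (source α) (p • y), ?_⟩
  have key : φ (N.mkQ v) = coeff (source α) (p • y) • N.mkQ v := by
    rw [← hfix _ _ hφv, ← hy, ← map_smul, hpy.eq_smul]
    simp [v, coeff_basisVec]
  refine LinearMap.ext fun z => ?_
  obtain ⟨u, rfl⟩ := N.mkQ_surjective z
  obtain ⟨h, rfl⟩ := Submodule.mem_span_singleton.1
    (span_source α ▸ Submodule.mem_top : u ∈ Submodule.span (H n) {v})
  rw [map_smul, map_smul, key, Module.algebraMap_end_apply, smul_comm]

theorem nonempty_end_algEquiv {N : Submodule (H n) (V α)} (hN : N ≠ ⊤) :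
    Nonempty (Module.End (H n) (V α ⧸ N) ≃ₐ[ℂ] ℂ) := by
  have : Nontrivial (V α ⧸ N) := Submodule.Quotient.nontrivial_iff.2 hN
  refine ⟨(AlgEquiv.ofBijective (Algebra.ofId ℂ (Module.End (H n) (V α ⧸ N)))
    ⟨(algebraMap ℂ (Module.End (H n) (V α ⧸ N))).injective, fun φ => ?_⟩).symm⟩
  obtain ⟨c, hc⟩ := exists_end_eq_smul N φ
  exact ⟨c, hc.symm⟩

theorem nonempty_hom_linearEquiv (α : Composition n) :
    Nonempty ((V α →ₗ[H n] V α) ≃ₗ[ℂ] ℂ) := by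
  have hid : (LinearMap.id : V α →ₗ[H n] V α) ≠ 0 := fun h =>
    V.basisVec_ne_zero (source α) (LinearMap.congr_fun h _)
  refine ⟨(LinearEquiv.ofBijective (LinearMap.toSpanSingleton ℂ (V α →ₗ[H n] V α) LinearMap.id)
    ⟨LinearMap.ker_eq_bot.1 (LinearMap.ker_toSpanSingleton ℂ hid), fun φ => ?_⟩).symm⟩
  have hfix : IsSourceFixed α (φ (V.basisVec (source α))) := fun i h => by
    rw [← map_smul, isSourceFixed_source α i h]
  refine ⟨coeff (source α) (φ (V.basisVec (source α))), LinearMap.ext fun u => ?_⟩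
  obtain ⟨h, rfl⟩ := Submodule.mem_span_singleton.1
    (span_source α ▸ Submodule.mem_top : u ∈ Submodule.span (H n) {V.basisVec (source α)})
  rw [LinearMap.toSpanSingleton_apply, LinearMap.smul_apply, LinearMap.id_apply, map_smul,
    smul_comm, ← hfix.eq_smul]

theorem subsingleton_hom (hle : LexLE β α) (hne : β ≠ α) :
    Subsingleton (V α →ₗ[H n] V β) := by
  refine subsingleton_of_forall_eq 0 fun φ => LinearMap.ext fun u => ?_
  have hfix : IsSourceFixed α (φ (V.basisVec (source α))) := fun i h => by
    rw [← map_smul, isSourceFixed_source α i h]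
  obtain ⟨h, rfl⟩ := Submodule.mem_span_singleton.1
    (span_source α ▸ Submodule.mem_top : u ∈ Submodule.span (H n) {V.basisVec (source α)})
  rw [map_smul, hfix.eq_zero hle hne, smul_zero, LinearMap.zero_apply]

end Syzygy

end ZeroHecke

theorem theorem5p4 (n : ℕ) (α : Composition n) :
    -- (a)
    (∀ β : Composition n, ZeroHecke.LexLE β α →
      Subsingleton (CategoryTheory.Abelian.Ext
        (ModuleCat.of (ZeroHecke.H n) (ZeroHecke.V α))
        (ModuleCat.of (ZeroHecke.H n) (ZeroHecke.V β)) 1)) ∧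
    ZeroHecke.IsEssentiallyRigid (ZeroHecke.H n) (ZeroHecke.V α) ∧
    -- (b)
    (∀ β : Composition n, ZeroHecke.LexLE β α →
      (β = α →
        Nonempty ((ZeroHecke.V α →ₗ[ZeroHecke.H n] ZeroHecke.V β) ≃ₗ[ℂ] ℂ)) ∧
      (β ≠ α → Subsingleton (ZeroHecke.V α →ₗ[ZeroHecke.H n] ZeroHecke.V β))) ∧
    -- (c)
    (∀ N : Submodule (ZeroHecke.H n) (ZeroHecke.V α), N ≠ ⊤ →
      Nonempty (Module.End (ZeroHecke.H n) (ZeroHecke.V α ⧸ N) ≃ₐ[ℂ] ℂ)) := by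
  refine ⟨fun β hle => ?_, ⟨ZeroHecke.exists_isProjectiveCover_V α, ?_⟩, fun β hle => ⟨?_, ?_⟩,
    fun N hN => ZeroHecke.nonempty_end_algEquiv hN⟩
  · obtain ⟨P, _, _, f, hf⟩ := ZeroHecke.exists_isProjectiveCover_V α
    have := hf.1
    exact ZeroHecke.subsingleton_ext_one f hf.2.1 fun g => hf.hom_ker_eq_zero hle g
  · intro P _ _ f hf g
    exact hf.hom_ker_eq_zero (Or.inl rfl) g
  · rintro rfl
    exact ZeroHecke.nonempty_hom_linearEquiv β
  · exact ZeroHecke.subsingleton_hom hle
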